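/- Let $T=\sum_{j=0}^{k}Q_j(w)\frac{d^j}{dw^j}$ be a differential operator of order $k\ge 1$ with polynomial coefficients $Q_j\in\mathbb{C}[w]$, $Q_k\not\equiv 0$. Suppose that $T$ is non-degenerate, i.e. $\max_{0\le j\le k}(\deg Q_j-j)=\deg Q_k-k$ (with $\deg 0=-\infty$), that $d:=\deg Q_k\ge 1$, and that all zeros of $Q_k$ are simple. For $n\ge k$ let $P_n(z,w)=T[(w-z)^n]/(w-z)^{n-k}$, a polynomial in $z$ and $w$ ($T$ acts on the variable $w$). Let $\Gamma_n\subset\hat{\mathbb{C}}\times\hat{\mathbb{C}}$ be the closure of the curve $\{(z,w)\in\mathbb{C}^2:P_n(z,w)=0\}$, and let $T_n$ be the multivalued map $T_n(z)=\{w\in\hat{\mathbb{C}}:(z,w)\in\Gamma_n\}$ of $\hat{\mathbb{C}}$. The number $\deg_w P_n$ is its degree. For a finite Borel measure $\mu$ on $\hat{\mathbb{C}}$ the measure $(T_n)_*\mu$ is given by $\int\varphi\,d(T_n)_*\mu=\int\sum_{x\in T_n(a)}\varphi(x)\,d\mu(a)$ for continuous $\varphi$, with the points of $T_n(a)$ counted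 with multiplicities; $(T_n^m)_*$ is the $m$-fold iterate. A set $K\subset\hat{\mathbb{C}}$ is forward invariant if $T_n(K)\subset K$. A closed non-empty set $S\subset\mathbb{C}$ is Hutchinson invariant in degree $n$ if for every $z\in S$ all zeros $w$ of $T[(w-z)^n]$ lie in $S$; the smallest such set (contained in all others), if it exists, is denoted by $M_{H,n}$. A point $z\in\mathbb{C}$ is an attracting periodic point of $T_n$ if for some $l\ge 1$ there is a local holomorphic branch $g$ of $T_n^l$ at $z$ with $g(z)=z$ and $|g'(z)|<1$. Then for every $\epsilon>0$ there is $N\ge k$ such that for all $n\ge N$ the following hold. 1. $T_n$ has degree $d$, and there is a probability measure $\mu_{T_n}$ on $\hat{\mathbb{C}}$ with $(T_n)_*\mu_{T_n}=d\,\mu_{T_n}$ such that for every $a\in\mathbb{C}$ $$\frac{1}{d^m}(T_n^m)_*(\delta_a)\longrightarrow\mu_{T_n}\quad\text{weak-}*\text{ as } m\to\infty .$$ Its support is contained in the $\epsilon$-neighbourhood of the zeros of $Q_k$, and is the smallest closed set that is forward invariant under $T_n$ and contains a point of $\mathbb{C}$. Moreover $M_{H,n}$ exists and $M_{H,n}=\operatorname{supp}\mu_{T_n}$.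 2. Each point of $M_{H,n}$ is the limit of a sequence of attracting periodic points of $T_n$ and is contained in the $\epsilon$-neighbourhood of the zeros of $Q_k$. 3. If $k\ge 2$, at least one $Q_j$ with $j\ne k$ is not identically zero, $d\ge 2$, and $Q_0,\dots,Q_k$ have no common zero (that is, $\Gamma_n$ contains no horizontal line $\hat{\mathbb{C}}\times\{c\}$), then $M_{H,n}$ is a Cantor set, i.e. it is homeomorphic to the ternary Cantor set. -/

import Mathlib

open Polynomial Topology Filter MeasureTheory

open scoped Polynomial.Bivariate

noncomputable section

namespace HolCorr

/-! The Riemann sphere is the one-point compactification `OnePoint ℂ`, with its Borel σ-algebra. -/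

instance instMeasurableSpaceSphere : MeasurableSpace (OnePoint ℂ) := borel _

instance instBorelSpaceSphere : BorelSpace (OnePoint ℂ) := ⟨rfl⟩

/-! ### Holomorphic correspondences on the Riemann sphere

A polynomial `P(z, w)` is an element of `ℂ[X][Y]`: the inner variable is `z`, the outer one `w`. -/

/-- The closure in the product of two spheres of the affine plane curve `P(z, w) = 0`. -/
def graph (P : ℂ[X][Y]) : Set (OnePoint ℂ × OnePoint ℂ) :=
  closure {p | ∃ z w : ℂ, p = ((z : OnePoint ℂ), (w : OnePoint ℂ)) ∧ P.evalEval z w = 0}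

/-- The set `F(z)` of images of `z` under the correspondence `F : z → w` defined by `P(z, w) = 0`. -/
def image (P : ℂ[X][Y]) (z : OnePoint ℂ) : Set (OnePoint ℂ) := {w | (z, w) ∈ graph P}

/-- The set `F^l(z)` of images of `z` under the `l`-th iterate of the correspondence. -/
def iterImage (P : ℂ[X][Y]) : ℕ → OnePoint ℂ → Set (OnePoint ℂ)
  | 0, z => {z}
  | l + 1, z => {w | ∃ v ∈ iterImage P l z, w ∈ image P v}

/-- `F(K) ⊆ K`. -/
def ForwardInvariant (P : ℂ[X][Y]) (K : Set (OnePoint ℂ)) : Prop :=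
  ∀ z ∈ K, image P z ⊆ K

/-- The polynomial in `w` which cuts out the part in `ℂ` of the fibre over `a`: it is `P(a, w)` for
`a ∈ ℂ`, and the coefficient of the highest power of `z` in `P(z, w)` for `a = ∞`. -/
def slice (P : ℂ[X][Y]) : OnePoint ℂ → ℂ[X]
  | OnePoint.infty => (Bivariate.swap P).leadingCoeff
  | OnePoint.some a => P.map (evalRingHom a)

/-- The points of `F(a)` counted with multiplicities: the intersection of the curve with
`{a} × OnePoint ℂ`, consisting of `deg_w P` points (when `{a} × OnePoint ℂ` is not contained in
the curve). Horizontal components `OnePoint ℂ × {c}` contribute the point `c` to every fibre. -/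
def fibre (P : ℂ[X][Y]) (a : OnePoint ℂ) : Multiset (OnePoint ℂ) :=
  (slice P a).roots.map (fun w : ℂ => (w : OnePoint ℂ)) +
    Multiset.replicate (P.natDegree - (slice P a).natDegree) OnePoint.infty

/-- The points of `F^m(a)` counted with multiplicities. -/
def iterFibre (P : ℂ[X][Y]) : ℕ → OnePoint ℂ → Multiset (OnePoint ℂ)
  | 0, a => {a}
  | m + 1, a => (iterFibre P m a).bind (fibre P)

/-- The measure `(F^m)_* δ_a`, the sum of the Dirac masses at the points of `F^m(a)`. -/
def pushDirac (P : ℂ[X][Y]) (m : ℕ) (a : OnePoint ℂ) : Measure (OnePoint ℂ) :=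
  ((iterFibre P m a).map Measure.dirac).sum

/-- `F_* μ = ν` for finite measures, by duality with continuous functions:
`∫ φ d(F_* μ) = ∫ (∑_{x ∈ F(a)} φ x) dμ(a)`, points counted with multiplicities. -/
def IsPushforward (P : ℂ[X][Y]) (μ ν : Measure (OnePoint ℂ)) : Prop :=
  ∀ φ : C(OnePoint ℂ, ℝ),
    Integrable (fun a => ((fibre P a).map φ).sum) μ ∧
      ∫ x, φ x ∂ν = ∫ a, ((fibre P a).map φ).sum ∂μ

/-- `z ∈ ℂ` is an attracting periodic point: for some `l ≥ 1` there is a local holomorphic branch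
`g` of `F^l` at `z` with `g(z) = z` and `|g'(z)| < 1`. -/
def IsAttractingPeriodic (P : ℂ[X][Y]) (z : ℂ) : Prop :=
  ∃ l : ℕ, 1 ≤ l ∧ ∃ g : ℂ → ℂ, AnalyticAt ℂ g z ∧
    (∀ᶠ x : ℂ in 𝓝 z, (g x : OnePoint ℂ) ∈ iterImage P l (x : OnePoint ℂ)) ∧
    g z = z ∧ ‖deriv g z‖ < 1

/-! ### Differential operators -/

/-- The operator `∑_{j ≤ k} Q_j(w) d^j/dw^j`. -/
def diffOp {R : Type*} [CommRing R] (k : ℕ) (Q : ℕ → Polynomial R) (f : Polynomial R) :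
    Polynomial R :=
  ∑ j ∈ Finset.range (k + 1), Q j * derivative^[j] f

/-- The operator `∑_{j ≤ k} Q_j(w) d^j/dw^j` has order `k` and is non-degenerate:
`max_{j ≤ k} (deg Q_j - j) = deg Q_k - k`, where `deg 0 = -∞`. -/
def NonDegenerate (k : ℕ) (Q : ℕ → ℂ[X]) : Prop :=
  Q k ≠ 0 ∧ ∀ j ≤ k, Q j ≠ 0 → ((Q j).natDegree : ℤ) - j ≤ ((Q k).natDegree : ℤ) - k

/-- The polynomial `T[(w - z)^n] / (w - z)^(n - k)` in `z` and `w` (for `n ≥ k`), where `T` acts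
on the variable `w`. -/
def corrPoly (k : ℕ) (Q : ℕ → ℂ[X]) (n : ℕ) : ℂ[X][Y] :=
  diffOp k (fun j => (Q j).map C) ((Y - C X) ^ n) /ₘ (Y - C X) ^ (n - k)

/-- The division in `corrPoly` is exact. -/
theorem diffOp_pow_eq_mul {R : Type*} [CommRing R] (k : ℕ) (Q : ℕ → Polynomial R) (a : R) (n : ℕ)
    (hn : k ≤ n) :
    diffOp k Q ((X - C a) ^ n) = (X - C a) ^ (n - k) *
      ∑ j ∈ Finset.range (k + 1), (n.descFactorial j) • (Q j * (X - C a) ^ (k - j)) := by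
  unfold diffOp
  rw [Finset.mul_sum]
  refine Finset.sum_congr rfl fun j hj => ?_
  have hj' : j ≤ k := by simpa [Nat.lt_succ_iff] using hj
  rw [iterate_derivative_X_sub_pow, show n - j = (n - k) + (k - j) by omega, pow_add]
  simp only [nsmul_eq_mul]
  ring

theorem corrPoly_eq (k : ℕ) (Q : ℕ → ℂ[X]) (n : ℕ) (hn : k ≤ n) :
    corrPoly k Q n = ∑ j ∈ Finset.range (k + 1),
      (n.descFactorial j) • ((Q j).map C * (Y - C X) ^ (k - j)) := by
  unfold corrPoly
  rw [diffOp_pow_eq_mul k _ (X : ℂ[X]) n hn]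
  exact mul_divByMonic_cancel_left _ ((monic_X_sub_C _).pow _)

/-- A closed non-empty `S ⊆ ℂ` is Hutchinson invariant in degree `n` for `T = ∑ Q_j d^j/dw^j` if for
every `z ∈ S` all zeros of `T[(w - z)^n]` lie in `S`. -/
def HutchinsonInvariant (k : ℕ) (Q : ℕ → ℂ[X]) (n : ℕ) (S : Set ℂ) : Prop :=
  IsClosed S ∧ S.Nonempty ∧
    ∀ z ∈ S, ∀ w : ℂ, (diffOp k Q ((X - C z) ^ n)).eval w = 0 → w ∈ S

/-- `S` is a Cantor set: it is homeomorphic to the ternary Cantor set. -/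
def IsCantorSet (S : Set ℂ) : Prop := Nonempty (S ≃ₜ cantorSet)

end HolCorr

end

/-!
Divide `P_n(z, w)` by the leading falling factorial `n^{(k)}`. The coefficient of
`Q_j(w) (w - z)^(k - j)` becomes `n^{(j)} / n^{(k)}`, which tends to `0` for `j < k`, so for `z` in
a fixed disc the polynomial is a small perturbation of `Q_k`. By non-degeneracy its degree in `w` is
still `d`, and for `z` outside of the disc all its zeros have modulus less than `|z| / 2` or lie in
the disc. Each simple zero `u` of `Q_k` hence yields one holomorphic branch of `T_n` on the disc,
with values close to `u` and with a contraction ratio `q` that is as small as we like; that is,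
`T_n` restricts to an iterated function system of `d` contractions there.

The averaging operator of this system, applied repeatedly to a continuous function, tends to a
constant, its integral against `μ_{T_n}`. The support of `μ_{T_n}` is the attractor, and it absorbs
all orbits in `ℂ`. Fixed points of long compositions of branches are attracting periodic points and
accumulate at every point of the attractor.

If `d q < 1`, the image of the attractor under any real-valued `1`-Lipschitz function is a null set,
so the attractor is totally disconnected. If moreover it is infinite, it is perfect, because in the
absence of horizontal lines the branches have finite fibres and each piece of it is infinite too. In
a finite invariant set every point would have `d` images and hence, by counting, `d` preimages.
Vieta's formula for the sum of the preimages then forces an extremal point of the set to be its own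
only preimage, which is impossible for `d ≥ 2`.
-/

noncomputable section

/-! ### Iterated function systems -/

namespace IFS

variable {ι X Z : Type*}

section Words

/-- The composition `f i₁ ∘ ⋯ ∘ f iₗ` along a word `[i₁, …, iₗ]`. -/
def wordMap (f : ι → X → X) (l : List ι) (x : X) : X := l.foldr f x

/-- `S` is the union of its images under the maps `f i`. -/
structure IsSelfSimilar (f : ι → X → X) (S : Set X) : Prop where
  mapsTo : ∀ i, Set.MapsTo (f i) S S
  covered : ∀ x ∈ S, ∃ i, ∃ y ∈ S, f i y = x

theorem IsSelfSimilar.image {f : ι → X → X} {g : ι → Z → Z} {j : X → Z} {S : Set X}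
    (hS : IsSelfSimilar f S) (hj : ∀ i, Function.Semiconj j (f i) (g i)) :
    IsSelfSimilar g (j '' S) where
  mapsTo := by
    rintro i _ ⟨x, hx, rfl⟩
    exact ⟨f i x, hS.mapsTo i hx, hj i x⟩
  covered := by
    rintro _ ⟨x, hx, rfl⟩
    obtain ⟨i, y, hy, rfl⟩ := hS.covered x hx
    exact ⟨i, j y, ⟨y, hy, rfl⟩, (hj i y).symm⟩

theorem IsSelfSimilar.exists_wordMap_eq {f : ι → X → X} {S : Set X} (hS : IsSelfSimilar f S)
    (m : ℕ) : ∀ x ∈ S, ∃ l : List ι, l.length = m ∧ ∃ y ∈ S, wordMap f l y = x := by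
  induction m with
  | zero => exact fun x hx => ⟨[], rfl, x, hx, rfl⟩
  | succ m ih =>
    intro x hx
    obtain ⟨i, y, hy, rfl⟩ := hS.covered x hx
    obtain ⟨l, rfl, z, hz, rfl⟩ := ih y hy
    exact ⟨i :: l, rfl, z, hz, rfl⟩

theorem mapsTo_wordMap {f : ι → X → X} {S : Set X} (hf : ∀ i, Set.MapsTo (f i) S S)
    (l : List ι) : Set.MapsTo (wordMap f l) S S := by
  induction l with
  | nil => exact Set.mapsTo_id S
  | cons i l ih => exact (hf i).comp ih

theorem lipschitzOnWith_wordMap [PseudoMetricSpace X] {f : ι → X → X} {S : Set X} {q : NNReal}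
    (hf : ∀ i, LipschitzOnWith q (f i) S) (hmaps : ∀ i, Set.MapsTo (f i) S S) (l : List ι) :
    LipschitzOnWith (q ^ l.length) (wordMap f l) S := by
  induction l with
  | nil =>
    rw [List.length_nil, pow_zero]
    exact LipschitzWith.id.lipschitzOnWith
  | cons i l ih =>
    rw [List.length_cons, pow_succ']
    exact (hf i).comp ih (mapsTo_wordMap hmaps l)

end Words

section Transfer

variable [TopologicalSpace X] [Fintype ι]

/-- The averaging operator `φ ↦ (1 / |ι|) ∑ i, φ ∘ f i` of an iterated function system; its adjoint
on measures is `μ ↦ (1 / |ι|) ∑ i, (f i)_* μ`. -/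
def transfer (f : ι → C(X, X)) : C(X, ℝ) →ₗ[ℝ] C(X, ℝ) where
  toFun φ := (Fintype.card ι : ℝ)⁻¹ • ∑ i, φ.comp (f i)
  map_add' φ ψ := by
    ext x
    simp [Finset.sum_add_distrib]
  map_smul' c φ := by
    ext x
    simp [← Finset.mul_sum, mul_left_comm]

theorem transfer_apply (f : ι → C(X, X)) (φ : C(X, ℝ)) (x : X) :
    transfer f φ x = (Fintype.card ι : ℝ)⁻¹ * ∑ i, φ (f i x) := by
  simp [transfer]

theorem transfer_pow_succ_apply (f : ι → C(X, X)) (φ : C(X, ℝ)) (m : ℕ) :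
    (transfer f ^ (m + 1)) φ = (transfer f ^ m) (transfer f φ) := by
  rw [pow_succ, Module.End.mul_apply]

theorem transfer_pow_succ_apply' (f : ι → C(X, X)) (φ : C(X, ℝ)) (m : ℕ) :
    (transfer f ^ (m + 1)) φ = transfer f ((transfer f ^ m) φ) := by
  rw [pow_succ', Module.End.mul_apply]

theorem transfer_pow_mono_on (f : ι → C(X, X)) {φ ψ : C(X, ℝ)} {K : Set X}
    (hK : ∀ i, Set.MapsTo (f i) K K) (h : ∀ x ∈ K, φ x ≤ ψ x) (m : ℕ) :
    ∀ x ∈ K, (transfer f ^ m) φ x ≤ (transfer f ^ m) ψ x := by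
  induction m with
  | zero => exact h
  | succ m ih =>
    intro x hx
    simp only [transfer_pow_succ_apply', transfer_apply]
    gcongr with i
    exact ih _ (hK i hx)

variable [Nonempty ι]

theorem transfer_pow_const (f : ι → C(X, X)) (c : ℝ) (m : ℕ) :
    (transfer f ^ m) (ContinuousMap.const X c) = ContinuousMap.const X c := by
  induction m with
  | zero => rfl
  | succ m ih =>
    rw [transfer_pow_succ_apply', ih]
    ext x
    simp [transfer_apply]

theorem transfer_pow_le_const (f : ι → C(X, X)) {φ : C(X, ℝ)} {c : ℝ} (h : ∀ x, φ x ≤ c) (m : ℕ)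
    (x : X) : (transfer f ^ m) φ x ≤ c := by
  simpa [transfer_pow_const] using transfer_pow_mono_on f (ψ := ContinuousMap.const X c)
    (fun _ => Set.mapsTo_univ _ _) (fun y _ => h y) m x trivial

theorem const_le_transfer_pow (f : ι → C(X, X)) {φ : C(X, ℝ)} {c : ℝ} (h : ∀ x, c ≤ φ x) (m : ℕ)
    (x : X) : c ≤ (transfer f ^ m) φ x := by
  simpa [transfer_pow_const] using transfer_pow_mono_on f (φ := ContinuousMap.const X c)
    (fun _ => Set.mapsTo_univ _ _) (fun y _ => h y) m x trivial

theorem abs_transfer_pow_sub_le (f : ι → C(X, X)) {φ : C(X, ℝ)} {e : ℝ}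
    (h : ∀ x y, φ x - φ y ≤ e) (m : ℕ) (x y : X) : |(transfer f ^ m) φ x - φ y| ≤ e := by
  have hupper := transfer_pow_le_const f (φ := φ) (c := φ y + e) (fun z => by linarith [h z y]) m x
  have hlower := const_le_transfer_pow f (φ := φ) (c := φ y - e) (fun z => by linarith [h y z]) m x
  rw [abs_le]
  constructor <;> linarith

end Transfer

section Equidistribution

open scoped CompactlySupported in
theorem exists_isProbabilityMeasure_integral_eq [TopologicalSpace X] [CompactSpace X]
    [T2Space X] [MeasurableSpace X] [BorelSpace X] (Λ : C(X, ℝ) →ₗ[ℝ] ℝ)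
    (hpos : ∀ φ : C(X, ℝ), (∀ x, 0 ≤ φ x) → 0 ≤ Λ φ)
    (hone : Λ (ContinuousMap.const X 1) = 1) :
    ∃ μ : Measure X, IsProbabilityMeasure μ ∧ ∀ φ : C(X, ℝ), ∫ x, φ x ∂μ = Λ φ := by
  let Λc : C_c(X, ℝ) →ₚ[ℝ] ℝ := PositiveLinearMap.mk₀
    { toFun := fun φ => Λ φ.toContinuousMap
      map_add' := fun φ ψ => Λ.map_add φ.toContinuousMap ψ.toContinuousMap
      map_smul' := fun r φ => Λ.map_smul r φ.toContinuousMap } fun φ hφ => hpos _ hφ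
  have hint (φ : C(X, ℝ)) : ∫ x, φ x ∂(RealRMK.rieszMeasure Λc) = Λ φ :=
    RealRMK.integral_rieszMeasure Λc (CompactlySupportedContinuousMap.continuousMapEquiv φ)
  refine ⟨RealRMK.rieszMeasure Λc, ⟨?_⟩, hint⟩
  have huniv := hint (ContinuousMap.const X 1)
  simp only [hone, ContinuousMap.const_apply, integral_const, smul_eq_mul, mul_one,
    measureReal_def] at huniv
  exact (ENNReal.toReal_eq_one_iff _).1 huniv

variable [Fintype ι]

/-- The iterates of the transfer operator converge pointwise to the integral against `μ`: the
normalized images of every Dirac mass converge to `μ` in the weak-* topology. -/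
def Equidistributes [TopologicalSpace X] [MeasurableSpace X] (f : ι → C(X, X)) (μ : Measure X) :
    Prop :=
  ∀ (φ : C(X, ℝ)) (x : X),
    Tendsto (fun m : ℕ => (transfer f ^ m) φ x) atTop (𝓝 (∫ y, φ y ∂μ))

variable [Nonempty ι]

theorem transfer_pow_sub_le [PseudoMetricSpace X] {f : ι → C(X, X)} {q : NNReal}
    (hf : ∀ i, LipschitzWith q (f i)) {φ : C(X, ℝ)} {δ e : ℝ}
    (h : ∀ x y, dist x y ≤ δ → φ x - φ y ≤ e) (m : ℕ) :
    ∀ x y, q ^ m * dist x y ≤ δ → (transfer f ^ m) φ x - (transfer f ^ m) φ y ≤ e := by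
  induction m with
  | zero => simpa using h
  | succ m ih =>
    intro x y hxy
    have hi (i : ι) : (transfer f ^ m) φ (f i x) - (transfer f ^ m) φ (f i y) ≤ e := by
      refine ih _ _ (le_trans ?_ hxy)
      rw [pow_succ, mul_assoc]
      gcongr
      exact (hf i).dist_le_mul x y
    have hcard : (0 : ℝ) < Fintype.card ι := by exact_mod_cast Fintype.card_pos
    rw [transfer_pow_succ_apply', transfer_apply, transfer_apply, ← mul_sub,
      ← Finset.sum_sub_distrib, inv_mul_le_iff₀ hcard]
    simpa using Finset.sum_le_sum fun i (_ : i ∈ Finset.univ) => hi i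

variable [MetricSpace X] [CompactSpace X] {f : ι → C(X, X)} {q : NNReal}

theorem exists_transfer_pow_sub_le (hq : q < 1) (hf : ∀ i, LipschitzWith q (f i)) (φ : C(X, ℝ))
    {e : ℝ} (he : 0 < e) : ∃ M : ℕ, ∀ x y, (transfer f ^ M) φ x - (transfer f ^ M) φ y ≤ e := by
  obtain ⟨δ, hδ, h⟩ := Metric.uniformContinuous_iff.1
    (CompactSpace.uniformContinuous_of_continuous φ.continuous) e he
  obtain ⟨D, hD⟩ := Metric.isBounded_iff.1
    (Metric.isBounded_of_compactSpace (s := (Set.univ : Set X)))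
  have hlim : Tendsto (fun m : ℕ => (q : ℝ) ^ m * D) atTop (𝓝 0) := by
    simpa using (tendsto_pow_atTop_nhds_zero_of_lt_one q.2 (by exact_mod_cast hq)).mul_const D
  obtain ⟨M, hM⟩ := (hlim.eventually (gt_mem_nhds (half_pos hδ))).exists
  refine ⟨M, fun x y => transfer_pow_sub_le hf (δ := δ / 2) (fun x y hxy => ?_) M x y ?_⟩
  · exact (le_abs_self _).trans (h (hxy.trans_lt (half_lt_self hδ))).le
  · exact (mul_le_mul_of_nonneg_left (hD trivial trivial) (by positivity)).trans hM.le

theorem exists_tendsto_transfer_pow (hq : q < 1) (hf : ∀ i, LipschitzWith q (f i))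
    (φ : C(X, ℝ)) :
    ∃ c : ℝ, ∀ x, Tendsto (fun m : ℕ => (transfer f ^ m) φ x) atTop (𝓝 c) := by
  rcases isEmpty_or_nonempty X with hX | ⟨⟨x₀⟩⟩
  · exact ⟨0, fun x => hX.elim x⟩
  have key : ∀ e > 0, ∃ M : ℕ, ∀ m ≥ M, ∀ x y,
      |(transfer f ^ m) φ x - (transfer f ^ M) φ y| ≤ e := by
    intro e he
    obtain ⟨M, hM⟩ := exists_transfer_pow_sub_le hq hf φ he
    refine ⟨M, fun m hm x y => ?_⟩
    obtain ⟨p, rfl⟩ := Nat.exists_eq_add_of_le' hm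
    rw [pow_add, Module.End.mul_apply]
    exact abs_transfer_pow_sub_le f hM p x y
  have hcauchy : CauchySeq (fun m : ℕ => (transfer f ^ m) φ x₀) := by
    rw [Metric.cauchySeq_iff']
    intro e he
    obtain ⟨M, hM⟩ := key (e / 2) (half_pos he)
    exact ⟨M, fun m hm => (hM m hm x₀ x₀).trans_lt (half_lt_self he)⟩
  obtain ⟨c, hc⟩ := cauchySeq_tendsto_of_complete hcauchy
  refine ⟨c, fun x => Metric.tendsto_atTop.2 fun e he => ?_⟩
  obtain ⟨M, hM⟩ := key (e / 3) (by positivity)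
  have hcM : |c - (transfer f ^ M) φ x₀| ≤ e / 3 :=
    le_of_tendsto (hc.sub_const _).abs (eventually_atTop.2 ⟨M, fun m hm => hM m hm x₀ x₀⟩)
  refine ⟨M, fun m hm => ?_⟩
  calc |(transfer f ^ m) φ x - c|
      ≤ |(transfer f ^ m) φ x - (transfer f ^ M) φ x₀| + |(transfer f ^ M) φ x₀ - c| :=
        abs_sub_le _ _ _
    _ ≤ e / 3 + e / 3 := add_le_add (hM m hm x x₀) (by rwa [abs_sub_comm])
    _ < e := by linarith

theorem exists_equidistributes [Nonempty X] [MeasurableSpace X] [BorelSpace X] (hq : q < 1)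
    (hf : ∀ i, LipschitzWith q (f i)) :
    ∃ μ : Measure X, IsProbabilityMeasure μ ∧ Equidistributes f μ := by
  choose c hc using exists_tendsto_transfer_pow hq hf
  obtain ⟨x₀⟩ := ‹Nonempty X›
  let Λ : C(X, ℝ) →ₗ[ℝ] ℝ :=
    linearMapOfTendsto c
      (fun m : ℕ => (ContinuousMap.evalCLM ℝ x₀).toLinearMap ∘ₗ (transfer f ^ m))
      (tendsto_pi_nhds.2 fun φ => hc φ x₀)
  have hpos (φ : C(X, ℝ)) (hφ : ∀ x, 0 ≤ φ x) : 0 ≤ c φ :=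
    ge_of_tendsto' (hc φ x₀) fun m => const_le_transfer_pow f hφ m x₀
  have hone : c (ContinuousMap.const X 1) = 1 := by
    refine tendsto_nhds_unique (hc _ x₀) ?_
    simp only [transfer_pow_const]
    exact tendsto_const_nhds
  obtain ⟨μ, hμ, hint⟩ := exists_isProbabilityMeasure_integral_eq Λ hpos hone
  exact ⟨μ, hμ, fun φ x => (hint φ).symm ▸ hc φ x⟩

end Equidistribution

section Support

variable [Fintype ι] [MetricSpace X] [MeasurableSpace X] {f : ι → C(X, X)} {μ : Measure X}

theorem Equidistributes.integral_transfer [Nonempty X] (hμ : Equidistributes f μ) (φ : C(X, ℝ)) :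
    ∫ y, transfer f φ y ∂μ = ∫ y, φ y ∂μ := by
  obtain ⟨x₀⟩ := ‹Nonempty X›
  refine tendsto_nhds_unique (hμ (transfer f φ) x₀) ?_
  simp_rw [← transfer_pow_succ_apply]
  exact (tendsto_add_atTop_iff_nat 1).2 (hμ φ x₀)

variable [CompactSpace X] [BorelSpace X] [IsProbabilityMeasure μ]

theorem Equidistributes.support_subset_of_mapsTo (hμ : Equidistributes f μ)
    {K : Set X} (hK : IsClosed K) (hne : K.Nonempty) (hfK : ∀ i, Set.MapsTo (f i) K K) :
    μ.support ⊆ K := by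
  obtain ⟨a, ha⟩ := hne
  let φ : C(X, ℝ) := ⟨fun x => Metric.infDist x K, Metric.continuous_infDist_pt K⟩
  have hφ : ∀ x ∈ K, φ x ≤ ContinuousMap.const X 0 x :=
    fun x hx => (Metric.infDist_zero_of_mem hx).le
  have hint : ∫ y, φ y ∂μ = 0 := by
    refine le_antisymm (le_of_tendsto' (hμ φ a) fun m => ?_)
      (integral_nonneg fun x => Metric.infDist_nonneg)
    have hle := transfer_pow_mono_on f hfK hφ m a ha
    rwa [show ContinuousMap.const X (0 : ℝ) = 0 from rfl, map_zero] at hle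
  have hae := (integral_eq_zero_iff_of_nonneg (fun x => Metric.infDist_nonneg)
    (φ.continuous.integrable_of_hasCompactSupport (HasCompactSupport.of_compactSpace _))).1 hint
  refine Measure.support_subset_of_isClosed hK ?_
  filter_upwards [hae] with x hx
  exact (hK.mem_iff_infDist_zero ⟨a, ha⟩).2 hx

variable [Nonempty ι]

theorem Equidistributes.mapsTo_support (hμ : Equidistributes f μ) (i : ι) :
    Set.MapsTo (f i) μ.support μ.support := by
  intro x hx
  have : Nonempty X := ⟨x⟩
  let φ : C(X, ℝ) := ⟨fun y => Metric.infDist y μ.support, Metric.continuous_infDist_pt _⟩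
  have htransfer_nonneg : ∀ y, 0 ≤ transfer f φ y :=
    fun y => const_le_transfer_pow f (φ := φ) (fun _ => Metric.infDist_nonneg) 1 y
  have hint : ∫ y, transfer f φ y ∂μ = 0 := by
    rw [hμ.integral_transfer]
    refine integral_eq_zero_of_ae ?_
    filter_upwards [Measure.support_mem_ae (μ := μ)] with y hy
    exact Metric.infDist_zero_of_mem hy
  have hae := (integral_eq_zero_iff_of_nonneg htransfer_nonneg
    ((transfer f φ).continuous.integrable_of_hasCompactSupport
      (HasCompactSupport.of_compactSpace _))).1 hint
  have hx0 : transfer f φ x = 0 := Measure.support_subset_of_isClosed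
    (isClosed_eq (transfer f φ).continuous continuous_const) hae hx
  rw [transfer_apply, mul_eq_zero_iff_left (by simp), Finset.sum_eq_zero_iff_of_nonneg
    (fun i _ => show 0 ≤ φ (f i x) from Metric.infDist_nonneg)] at hx0
  exact (Measure.isClosed_support.mem_iff_infDist_zero ⟨x, hx⟩).2 (hx0 i (Finset.mem_univ i))

theorem Equidistributes.isSelfSimilar_support (hμ : Equidistributes f μ) :
    IsSelfSimilar (fun i => f i) μ.support where
  mapsTo := hμ.mapsTo_support
  covered := by
    intro x hx
    have hclosed : IsClosed (⋃ i, f i '' μ.support) := isClosed_iUnion_of_finite fun i =>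
      (Measure.isClosed_support.isCompact.image (f i).continuous).isClosed
    have hsub : μ.support ⊆ ⋃ i, f i '' μ.support := by
      refine hμ.support_subset_of_mapsTo hclosed ?_ fun i y hy => ?_
      · exact ⟨f (Classical.arbitrary ι) x, Set.mem_iUnion.2 ⟨_, x, hx, rfl⟩⟩
      · obtain ⟨j, z, hz, rfl⟩ := Set.mem_iUnion.1 hy
        exact Set.mem_iUnion.2 ⟨i, f j z, hμ.mapsTo_support j hz, rfl⟩
    obtain ⟨i, y, hy, hyx⟩ := Set.mem_iUnion.1 (hsub hx)
    exact ⟨i, y, hy, hyx⟩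

end Support

end IFS

/-! ### Brouwer's theorem and Cantor attractors -/

namespace ClopenSplitting

open TopologicalSpace

variable {X : Type*} [TopologicalSpace X]

theorem coe_nonempty_iff {A : Clopens X} : (A : Set X).Nonempty ↔ A ≠ ⊥ := by
  rw [Set.nonempty_iff_ne_empty, ← Clopens.coe_bot, SetLike.coe_ne_coe]

section Split

variable [CompactSpace X] [T2Space X] [TotallyDisconnectedSpace X]

theorem exists_clopens_mem_notMem {x y : X} (h : x ≠ y) : ∃ U : Clopens X, x ∈ U ∧ y ∉ U := by
  have : TotallySeparatedSpace X := inferInstance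
  obtain ⟨U, hU, hxU, hyU⟩ := exists_isClopen_of_totally_separated h
  exact ⟨⟨U, hU⟩, hxU, hyU⟩

variable [PerfectSpace X]

theorem exists_inf_ne_bot_sdiff_ne_bot {A : Clopens X} (hA : A ≠ ⊥) :
    ∃ U : Clopens X, A ⊓ U ≠ ⊥ ∧ A \ U ≠ ⊥ := by
  obtain ⟨x, hx⟩ := coe_nonempty_iff.2 hA
  have : (𝓝[≠] x).NeBot := inferInstance
  obtain ⟨y, hyx, hyA⟩ := this.nonempty_of_mem
    (inter_mem_nhdsWithin {x}ᶜ (A.isClopen.isOpen.mem_nhds hx))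
  obtain ⟨U, hxU, hyU⟩ := exists_clopens_mem_notMem (Ne.symm hyx)
  exact ⟨U, coe_nonempty_iff.1 ⟨x, hx, hxU⟩, coe_nonempty_iff.1 ⟨y, hyA, hyU⟩⟩

theorem exists_clopens_split (C : Clopens X) {A : Clopens X} (hA : A ≠ ⊥) :
    ∃ B : Clopens X, A ⊓ B ≠ ⊥ ∧ A \ B ≠ ⊥ ∧
      (A ⊓ B ≤ C ∨ Disjoint (A ⊓ B) C) ∧ (A \ B ≤ C ∨ Disjoint (A \ B) C) := by
  by_cases h : A ⊓ C ≠ ⊥ ∧ A \ C ≠ ⊥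
  · exact ⟨C, h.1, h.2, Or.inl inf_le_right, Or.inr disjoint_sdiff_self_left⟩
  · have hAC : A ≤ C ∨ Disjoint A C := by
      rwa [← sdiff_eq_bot_iff, disjoint_iff, or_comm, or_iff_not_and_not]
    obtain ⟨U, hinf, hsdiff⟩ := exists_inf_ne_bot_sdiff_ne_bot hA
    exact ⟨U, hinf, hsdiff, hAC.imp inf_le_left.trans (·.mono_left inf_le_left),
      hAC.imp sdiff_le.trans (·.mono_left sdiff_le)⟩

end Split

/-- The half selected by `b` when the `n`-th splitting rule cuts the clopen set `A` into `A ⊓ s n A`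
and `A \ s n A`. -/
def half (s : ℕ → Clopens X → Clopens X) (n : ℕ) (A : Clopens X) (b : Bool) : Clopens X :=
  if b then A ⊓ s n A else A \ s n A

/-- The clopen set with address `ω 0, …, ω (n - 1)` in the scheme of successive splittings. -/
def cell (s : ℕ → Clopens X → Clopens X) (ω : ℕ → Bool) : ℕ → Clopens X
  | 0 => ⊤
  | n + 1 => half s n (cell s ω n) (ω n)

open Classical in
/-- The clopen set of level `n` containing `x`. -/
def cellAt (s : ℕ → Clopens X → Clopens X) (x : X) : ℕ → Clopens X
  | 0 => ⊤
  | n + 1 => half s n (cellAt s x n) (decide (x ∈ s n (cellAt s x n)))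

open Classical in
/-- The infinite address of `x`: the halves containing `x` in the successive splittings. -/
def address (s : ℕ → Clopens X → Clopens X) (x : X) (n : ℕ) : Bool :=
  decide (x ∈ s n (cellAt s x n))

variable {s : ℕ → Clopens X → Clopens X}

theorem half_le (n : ℕ) (A : Clopens X) (b : Bool) : half s n A b ≤ A := by
  cases b
  · exact sdiff_le
  · exact inf_le_left

theorem mem_half_iff {n : ℕ} {A : Clopens X} {x : X} (hx : x ∈ A) (b : Bool) :
    x ∈ half s n A b ↔ (b = true ↔ x ∈ s n A) := by
  cases b
  · simp only [Bool.false_eq_true, false_iff]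
    exact and_iff_right hx
  · simp only [true_iff]
    exact and_iff_right hx

theorem mem_cellAt (x : X) (n : ℕ) : x ∈ cellAt s x n := by
  classical
  induction n with
  | zero => trivial
  | succ n ih =>
    rw [cellAt, mem_half_iff ih]
    exact decide_eq_true_iff

theorem cell_address (x : X) (n : ℕ) : cell s (address s x) n = cellAt s x n := by
  induction n with
  | zero => rfl
  | succ n ih => rw [cell, ih]; rfl

theorem eq_decide_of_mem_half {n : ℕ} {A : Clopens X} {x : X} {b : Bool}
    [Decidable (x ∈ s n A)] (hx : x ∈ half s n A b) : b = decide (x ∈ s n A) := by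
  rw [Bool.eq_iff_iff, decide_eq_true_iff]
  exact (mem_half_iff (half_le n A b hx) b).1 hx

theorem cell_eq_cellAt {ω : ℕ → Bool} {x : X} {n : ℕ} (hx : x ∈ cell s ω n) :
    cell s ω n = cellAt s x n := by
  classical
  induction n with
  | zero => rfl
  | succ n ih =>
    rw [cell, cellAt, eq_decide_of_mem_half hx, ih (half_le n _ _ hx)]

theorem eq_address_of_mem_cell {ω : ℕ → Bool} {x : X} {n : ℕ} (hx : x ∈ cell s ω (n + 1)) :
    ω n = address s x n := by
  classical
  rw [address, ← cell_eq_cellAt (half_le n _ _ hx)]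
  exact eq_decide_of_mem_half hx

theorem continuous_address : Continuous (address s) := by
  refine continuous_pi fun n => IsLocallyConstant.continuous
    ((IsLocallyConstant.iff_eventually_eq _).2 fun x => ?_)
  filter_upwards [(cellAt s x (n + 1)).isClopen.isOpen.mem_nhds (mem_cellAt x (n + 1))] with y hy
  rw [← cell_address] at hy
  exact (eq_address_of_mem_cell hy).symm

theorem surjective_address [CompactSpace X] (hne : ∀ ω n, cell s ω n ≠ ⊥) :
    Function.Surjective (address s) := by
  intro ω
  obtain ⟨x, hx⟩ := IsCompact.nonempty_iInter_of_sequence_nonempty_isCompact_isClosed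
    (fun n => (cell s ω n : Set X)) (fun n => half_le n _ _)
    (fun n => coe_nonempty_iff.2 (hne ω n))
    (cell s ω 0).isClopen.isClosed.isCompact (fun n => (cell s ω n).isClopen.isClosed)
  exact ⟨x, funext fun n => (eq_address_of_mem_cell (Set.mem_iInter.1 hx (n + 1))).symm⟩

theorem injective_address [CompactSpace X] [T2Space X] [TotallyDisconnectedSpace X]
    {C : ℕ → Clopens X} (hC : Function.Surjective C)
    (hsep : ∀ ω n, cell s ω (n + 1) ≤ C n ∨ Disjoint (cell s ω (n + 1)) (C n)) :
    Function.Injective (address s) := by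
  intro x y hxy
  by_contra hne
  obtain ⟨U, hxU, hyU⟩ := exists_clopens_mem_notMem hne
  obtain ⟨n, rfl⟩ := hC U
  have hx : x ∈ cell s (address s x) (n + 1) := cell_address x _ ▸ mem_cellAt x _
  have hy : y ∈ cell s (address s x) (n + 1) := by
    rw [hxy, cell_address]
    exact mem_cellAt y _
  rcases hsep (address s x) n with h | h
  · exact hyU (h hy)
  · exact (disjoint_iff.1 h).le (show x ∈ cell s (address s x) (n + 1) ⊓ C n from ⟨hx, hxU⟩)

/-- **Brouwer's theorem** characterizing the Cantor space. -/
theorem nonempty_homeomorph (X : Type*) [TopologicalSpace X] [CompactSpace X] [T2Space X]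
    [TotallyDisconnectedSpace X] [SecondCountableTopology X] [PerfectSpace X] [Nonempty X] :
    Nonempty (X ≃ₜ (ℕ → Bool)) := by
  have : Countable (Clopens X) := Clopens.countable_iff_secondCountable.2 inferInstance
  obtain ⟨C, hC⟩ := exists_surjective_nat (Clopens X)
  have hsplit (n : ℕ) (A : Clopens X) : ∃ B : Clopens X, A ≠ ⊥ → A ⊓ B ≠ ⊥ ∧ A \ B ≠ ⊥ ∧
      (A ⊓ B ≤ C n ∨ Disjoint (A ⊓ B) (C n)) ∧ (A \ B ≤ C n ∨ Disjoint (A \ B) (C n)) := by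
    by_cases hA : A ≠ ⊥
    · exact (exists_clopens_split (C n) hA).imp fun B hB _ => hB
    · exact ⟨⊥, fun h => absurd h hA⟩
  choose s hs using hsplit
  have hhalf (n : ℕ) (A : Clopens X) (b : Bool) (hA : A ≠ ⊥) :
      half s n A b ≠ ⊥ ∧ (half s n A b ≤ C n ∨ Disjoint (half s n A b) (C n)) := by
    obtain ⟨hne, hne', hsep, hsep'⟩ := hs n A hA
    cases b
    · exact ⟨hne', hsep'⟩
    · exact ⟨hne, hsep⟩
  have hne (ω : ℕ → Bool) (n : ℕ) : cell s ω n ≠ ⊥ := by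
    induction n with
    | zero => exact coe_nonempty_iff.1 Set.univ_nonempty
    | succ n ih => exact (hhalf n _ _ ih).1
  have hbij : Function.Bijective (address s) :=
    ⟨injective_address hC fun ω n => (hhalf n _ _ (hne ω n)).2, surjective_address hne⟩
  exact ⟨continuous_address.homeoOfEquivCompactToT2 (f := Equiv.ofBijective _ hbij)⟩

end ClopenSplitting

namespace IFS

section CantorAttractor

variable {ι X : Type*} {f : ι → X → X} {S : Set X} {q : NNReal}

theorem ediam_image_wordMap_le [PseudoMetricSpace X] (hf : ∀ i, LipschitzOnWith q (f i) S)
    (hS : IsSelfSimilar f S) (l : List ι) :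
    Metric.ediam (wordMap f l '' S) ≤ (q : ENNReal) ^ l.length * Metric.ediam S := by
  refine Metric.ediam_image_le_iff.2 fun x hx y hy => ?_
  have hle := lipschitzOnWith_wordMap hf hS.mapsTo l hx hy
  push_cast at hle
  exact hle.trans (by gcongr; exact Metric.edist_le_ediam_of_mem hx hy)

theorem infinite_image_wordMap (hmaps : ∀ i, Set.MapsTo (f i) S S)
    (hfib : ∀ i, ∀ y ∈ S, {z ∈ S | f i z = y}.Finite) (hinf : S.Infinite) (l : List ι) :
    (wordMap f l '' S).Infinite := by
  induction l with
  | nil => rwa [show wordMap f [] '' S = S from Set.image_id S]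
  | cons i l ih =>
    intro hfin
    refine ih (Set.Finite.of_finite_fibers (f i) (hfin.subset ?_) ?_)
    · rintro _ ⟨_, ⟨x, hx, rfl⟩, rfl⟩
      exact ⟨x, hx, rfl⟩
    · rintro _ ⟨_, ⟨x, hx, rfl⟩, rfl⟩
      refine (hfib i _ (hmaps i (mapsTo_wordMap hmaps l hx))).subset ?_
      rintro _ ⟨⟨z, hz, rfl⟩, hz'⟩
      exact ⟨mapsTo_wordMap hmaps l hz, hz'⟩

theorem exists_ne_dist_lt [MetricSpace X] (hq : q < 1) (hf : ∀ i, LipschitzOnWith q (f i) S)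
    (hS : IsSelfSimilar f S) (hfib : ∀ i, ∀ y ∈ S, {z ∈ S | f i z = y}.Finite)
    (hbdd : Bornology.IsBounded S) (hinf : S.Infinite) {x : X} (hx : x ∈ S) {e : ℝ} (he : 0 < e) :
    ∃ y ∈ S, y ≠ x ∧ dist x y < e := by
  have hlim : Tendsto (fun m : ℕ => (q : ℝ) ^ m * Metric.diam S) atTop (𝓝 0) := by
    simpa only [zero_mul] using
      (tendsto_pow_atTop_nhds_zero_of_lt_one q.coe_nonneg (NNReal.coe_lt_one.2 hq)).mul_const
        (Metric.diam S)
  obtain ⟨m, hm⟩ := (hlim.eventually_lt_const he).exists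
  obtain ⟨l, rfl, y, hy, rfl⟩ := hS.exists_wordMap_eq m x hx
  obtain ⟨_, ⟨z, hz, rfl⟩, hne⟩ :=
    (infinite_image_wordMap hS.mapsTo hfib hinf l).exists_notMem_finite
      (Set.finite_singleton (wordMap f l y))
  refine ⟨wordMap f l z, mapsTo_wordMap hS.mapsTo l hz, hne, ?_⟩
  calc dist (wordMap f l y) (wordMap f l z)
      ≤ (q ^ l.length : NNReal) * dist y z :=
        (lipschitzOnWith_wordMap hf hS.mapsTo l).dist_le_mul y hy z hz
    _ ≤ q ^ l.length * Metric.diam S := by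
        push_cast
        gcongr
        exact Metric.dist_le_diam_of_mem hbdd hy hz
    _ < e := hm

variable [Fintype ι]

theorem volume_image_le [PseudoMetricSpace X] (hf : ∀ i, LipschitzOnWith q (f i) S)
    (hS : IsSelfSimilar f S) {u : X → ℝ} (hu : LipschitzWith 1 u) (m : ℕ) :
    volume (u '' S) ≤ (Fintype.card ι * q : ENNReal) ^ m * Metric.ediam S := by
  have hcover : u '' S ⊆ ⋃ l : List.Vector ι m, u '' (wordMap f l.1 '' S) := by
    rintro _ ⟨x, hx, rfl⟩
    obtain ⟨l, hl, y, hy, hyx⟩ := hS.exists_wordMap_eq m x hx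
    exact Set.mem_iUnion.2 ⟨⟨l, hl⟩, x, ⟨y, hy, hyx⟩, rfl⟩
  have hword (l : List.Vector ι m) :
      volume (u '' (wordMap f l.1 '' S)) ≤ (q : ENNReal) ^ m * Metric.ediam S := by
    refine (Real.volume_le_diam _).trans ((hu.ediam_image_le _).trans ?_)
    simpa only [ENNReal.coe_one, one_mul, l.2] using ediam_image_wordMap_le hf hS l.1
  calc volume (u '' S) ≤ ∑ l : List.Vector ι m, volume (u '' (wordMap f l.1 '' S)) :=
        (measure_mono hcover).trans (measure_iUnion_fintype_le _ _)
    _ ≤ ∑ _l : List.Vector ι m, (q : ENNReal) ^ m * Metric.ediam S :=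
        Finset.sum_le_sum fun l _ => hword l
    _ = (Fintype.card ι * q : ENNReal) ^ m * Metric.ediam S := by
        simp only [Finset.sum_const, Finset.card_univ, card_vector, nsmul_eq_mul, Nat.cast_pow]
        rw [mul_pow, mul_assoc]

theorem volume_image_eq_zero [PseudoMetricSpace X] (hq : Fintype.card ι * q < 1)
    (hf : ∀ i, LipschitzOnWith q (f i) S) (hS : IsSelfSimilar f S) (hbdd : Bornology.IsBounded S)
    {u : X → ℝ} (hu : LipschitzWith 1 u) : volume (u '' S) = 0 := by
  have hlim : Tendsto (fun m : ℕ => (Fintype.card ι * q : ENNReal) ^ m * Metric.ediam S) atTop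
      (𝓝 (0 * Metric.ediam S)) :=
    ENNReal.Tendsto.mul_const
      (ENNReal.tendsto_pow_atTop_nhds_zero_of_lt_one (by exact_mod_cast hq))
      (Or.inr hbdd.ediam_ne_top)
  rw [zero_mul] at hlim
  exact nonpos_iff_eq_zero.1 (ge_of_tendsto' hlim (volume_image_le hf hS hu))

theorem isTotallyDisconnected [MetricSpace X] (hq : Fintype.card ι * q < 1)
    (hf : ∀ i, LipschitzOnWith q (f i) S) (hS : IsSelfSimilar f S)
    (hbdd : Bornology.IsBounded S) : IsTotallyDisconnected S := by
  intro C hCS hC x hx y hy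
  have hIcc : Set.Icc 0 (dist x y) ⊆ dist x '' S :=
    ((hC.image (dist x) (by fun_prop)).Icc_subset ⟨x, hx, dist_self x⟩ ⟨y, hy, rfl⟩).trans
      (Set.image_mono hCS)
  have hzero : volume (Set.Icc 0 (dist x y)) = 0 :=
    measure_mono_null hIcc (volume_image_eq_zero hq hf hS hbdd (LipschitzWith.dist_right x))
  rw [Real.volume_Icc, sub_zero, ENNReal.ofReal_eq_zero] at hzero
  exact dist_le_zero.1 hzero

theorem nonempty_homeomorph_cantorSet [MetricSpace X] (hq : Fintype.card ι * q < 1)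
    (hf : ∀ i, LipschitzOnWith q (f i) S) (hS : IsSelfSimilar f S)
    (hfib : ∀ i, ∀ y ∈ S, {z ∈ S | f i z = y}.Finite) (hcomp : IsCompact S) (hinf : S.Infinite) :
    Nonempty (S ≃ₜ cantorSet) := by
  obtain ⟨x₀, hx₀⟩ := hinf.nonempty
  have : Nonempty ι := ⟨(hS.covered x₀ hx₀).choose⟩
  have hq1 : q < 1 := lt_of_le_of_lt
    (le_mul_of_one_le_left q.2 (by exact_mod_cast Nat.one_le_iff_ne_zero.2 Fintype.card_ne_zero)) hq
  have : CompactSpace S := isCompact_iff_compactSpace.1 hcomp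
  have : TotallyDisconnectedSpace S := totallyDisconnectedSpace_subtype_iff.2
    (isTotallyDisconnected hq hf hS hcomp.isBounded)
  have : Nonempty S := ⟨x₀, hx₀⟩
  have : PerfectSpace S := by
    rw [perfectSpace_iff_forall_not_isolated]
    rintro ⟨x, hx⟩
    rw [← mem_closure_iff_nhdsWithin_neBot, Metric.mem_closure_iff]
    intro e he
    obtain ⟨y, hy, hne, hdist⟩ := exists_ne_dist_lt hq1 hf hS hfib hcomp.isBounded hinf hx he
    exact ⟨⟨y, hy⟩, fun h => hne (congrArg Subtype.val h), hdist⟩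
  obtain ⟨e⟩ := ClopenSplitting.nonempty_homeomorph S
  exact ⟨e.trans cantorSetHomeomorphNatToBool.symm⟩

end CantorAttractor

end IFS

namespace HolCorr

/-! ### Zeros of the perturbed polynomials -/

section Weights

/-- The limit of weights `c 0, …, c k = 1` in which each weight is negligible compared to the
next one. A statement holds for all sufficiently small weights if it holds eventually along this
filter. -/
def smallWeights (k : ℕ) : Filter (ℕ → ℂ) :=
  𝓟 {c | c k = 1 ∧ ∀ j ≤ k, c j ≠ 0} ⊓
    ⨅ j ∈ Finset.range k, comap (fun c => c j / c (j + 1)) (𝓝 0)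

theorem eventually_smallWeights_top (k : ℕ) : ∀ᶠ c in smallWeights k, c k = 1 :=
  (eventually_principal.2 fun _ hc => hc.1).filter_mono inf_le_left

theorem eventually_smallWeights_ne_zero (k : ℕ) : ∀ᶠ c in smallWeights k, ∀ j ≤ k, c j ≠ 0 :=
  (eventually_principal.2 fun _ hc => hc.2).filter_mono inf_le_left

theorem tendsto_smallWeights_div {k j : ℕ} (hj : j < k) :
    Tendsto (fun c : ℕ → ℂ => c j / c (j + 1)) (smallWeights k) (𝓝 0) :=
  tendsto_comap.mono_left (inf_le_right.trans (iInf₂_le j (Finset.mem_range.2 hj)))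

theorem tendsto_smallWeights_iff {α : Type*} {l : Filter α} {k : ℕ} {c : α → ℕ → ℂ} :
    Tendsto c l (smallWeights k) ↔ (∀ᶠ a in l, c a k = 1 ∧ ∀ j ≤ k, c a j ≠ 0) ∧
      ∀ j < k, Tendsto (fun a => c a j / c a (j + 1)) l (𝓝 0) := by
  simp only [smallWeights, tendsto_inf, tendsto_principal, tendsto_iInf, tendsto_comap_iff,
    Finset.mem_range, Set.mem_ofPred_eq, Function.comp_def]

theorem tendsto_smallWeights_apply {k j : ℕ} (hj : j ≤ k) :
    Tendsto (fun c : ℕ → ℂ => c j) (smallWeights k) (𝓝 (if j = k then 1 else 0)) := by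
  induction hj using Nat.decreasingInduction with
  | self =>
    rw [if_pos rfl]
    exact tendsto_const_nhds.congr' ((eventually_smallWeights_top k).mono fun _ hc => hc.symm)
  | of_succ j hj ih =>
    have hprod := (tendsto_smallWeights_div hj).mul ih
    rw [zero_mul] at hprod
    rw [if_neg hj.ne]
    refine hprod.congr' ((eventually_smallWeights_ne_zero k).mono fun c hc => ?_)
    exact div_mul_cancel₀ _ (hc _ hj)

theorem tendsto_sum_norm_mul (k : ℕ) (A : ℕ → ℝ) :
    Tendsto (fun c : ℕ → ℂ => ∑ j ∈ Finset.range k, ‖c j‖ * A j) (smallWeights k) (𝓝 0) := by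
  have hterm (j : ℕ) (hj : j ∈ Finset.range k) :
      Tendsto (fun c : ℕ → ℂ => ‖c j‖ * A j) (smallWeights k) (𝓝 0) := by
    have hj' := Finset.mem_range.1 hj
    have hlim := (tendsto_smallWeights_apply hj'.le).norm.mul_const (A j)
    rwa [if_neg hj'.ne, norm_zero, zero_mul] at hlim
  simpa only [Finset.sum_const_zero] using tendsto_finsetSum _ hterm

theorem eventually_sum_norm_mul_le (k : ℕ) (A : ℕ → ℝ) {e : ℝ} (he : 0 < e) :
    ∀ᶠ c in smallWeights k, ∑ j ∈ Finset.range k, ‖c j‖ * A j ≤ e :=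
  (tendsto_sum_norm_mul k A).eventually_le_const he

end Weights

section Perturbation

/-- The polynomial `∑ j ≤ k, c j • Q j(w) (w - z)^(k - j)` in `w`. For `c j = n^{(j)} / n^{(k)}`, a
ratio of falling factorials, it is the normalized polynomial of the correspondence. -/
def weighted (k : ℕ) (Q : ℕ → ℂ[X]) (c : ℕ → ℂ) (z : ℂ) : ℂ[X] :=
  ∑ j ∈ Finset.range (k + 1), C (c j) * (Q j * (X - C z) ^ (k - j))

/-- The value at `w` of the part of `weighted` coming from the indices `j < k`. -/
def perturbation (k : ℕ) (Q : ℕ → ℂ[X]) (c : ℕ → ℂ) (z w : ℂ) : ℂ :=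
  ∑ j ∈ Finset.range k, c j * ((Q j).eval w * (w - z) ^ (k - j))

variable {k : ℕ} {Q : ℕ → ℂ[X]} {c : ℕ → ℂ}

theorem eval_weighted (k : ℕ) (Q : ℕ → ℂ[X]) (c : ℕ → ℂ) (z w : ℂ) :
    (weighted k Q c z).eval w =
      ∑ j ∈ Finset.range (k + 1), c j * ((Q j).eval w * (w - z) ^ (k - j)) := by
  simp [weighted, eval_finsetSum]

theorem eval_weighted_eq_add (Q : ℕ → ℂ[X]) (hc : c k = 1) (z w : ℂ) :
    (weighted k Q c z).eval w = (Q k).eval w + perturbation k Q c z w := by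
  rw [eval_weighted, Finset.sum_range_succ, hc, Nat.sub_self, pow_zero, mul_one, one_mul, add_comm,
    perturbation]

theorem NonDegenerate.natDegree_add_le (hT : NonDegenerate k Q) {j : ℕ} (hj : j ≤ k)
    (h0 : Q j ≠ 0) : (Q j).natDegree + (k - j) ≤ (Q k).natDegree := by
  have := hT.2 j hj h0
  omega

theorem exists_forall_norm_eval_le (p : ℂ[X]) :
    ∃ A : ℝ, 0 ≤ A ∧ ∀ w : ℂ, ‖p.eval w‖ ≤ A * (1 + ‖w‖) ^ p.natDegree := by
  refine ⟨∑ i ∈ Finset.range (p.natDegree + 1), ‖p.coeff i‖,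
    Finset.sum_nonneg fun i _ => norm_nonneg _, fun w => ?_⟩
  rw [eval_eq_sum_range, Finset.sum_mul]
  refine norm_sum_le_of_le _ fun i hi => ?_
  rw [norm_mul, norm_pow]
  gcongr
  calc ‖w‖ ^ i ≤ (1 + ‖w‖) ^ i := by gcongr; linarith
    _ ≤ (1 + ‖w‖) ^ p.natDegree := pow_le_pow_right₀ (by linarith [norm_nonneg w])
      (Nat.lt_succ_iff.1 (Finset.mem_range.1 hi))

theorem NonDegenerate.exists_norm_eval_mul_le (hT : NonDegenerate k Q) {j : ℕ} (hj : j ≤ k) :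
    ∃ A : ℝ, ∀ z w : ℂ,
      ‖(Q j).eval w * (w - z) ^ (k - j)‖ ≤ A * (1 + ‖w‖ + ‖z‖) ^ (Q k).natDegree := by
  by_cases h0 : Q j = 0
  · exact ⟨0, fun z w => by simp [h0]⟩
  obtain ⟨A, hA0, hA⟩ := exists_forall_norm_eval_le (Q j)
  refine ⟨A, fun z w => ?_⟩
  have hz := norm_nonneg z
  have hw := norm_nonneg w
  calc ‖(Q j).eval w * (w - z) ^ (k - j)‖
      ≤ A * (1 + ‖w‖) ^ (Q j).natDegree * (‖w‖ + ‖z‖) ^ (k - j) := by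
        rw [norm_mul, norm_pow]
        gcongr
        exacts [hA w, norm_sub_le w z]
    _ ≤ A * (1 + ‖w‖ + ‖z‖) ^ (Q j).natDegree * (1 + ‖w‖ + ‖z‖) ^ (k - j) := by
        gcongr A * ?_ ^ _ * ?_ ^ _ <;> linarith
    _ = A * (1 + ‖w‖ + ‖z‖) ^ ((Q j).natDegree + (k - j)) := by rw [mul_assoc, pow_add]
    _ ≤ A * (1 + ‖w‖ + ‖z‖) ^ (Q k).natDegree := by
        gcongr
        exacts [by linarith, hT.natDegree_add_le hj h0]

theorem NonDegenerate.eventually_norm_perturbation_le (hT : NonDegenerate k Q) {e : ℝ}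
    (he : 0 < e) : ∀ᶠ c in smallWeights k, ∀ z w : ℂ,
      ‖perturbation k Q c z w‖ ≤ e * (1 + ‖w‖ + ‖z‖) ^ (Q k).natDegree := by
  have hterm (j : ℕ) : ∃ A : ℝ, j < k → ∀ z w : ℂ,
      ‖(Q j).eval w * (w - z) ^ (k - j)‖ ≤ A * (1 + ‖w‖ + ‖z‖) ^ (Q k).natDegree := by
    by_cases hj : j < k
    · obtain ⟨A, hA⟩ := hT.exists_norm_eval_mul_le hj.le
      exact ⟨A, fun _ => hA⟩
    · exact ⟨0, fun h => absurd h hj⟩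
  choose A hA using hterm
  filter_upwards [eventually_sum_norm_mul_le k A he] with c hc z w
  calc ‖perturbation k Q c z w‖
      ≤ ∑ j ∈ Finset.range k, ‖c j‖ * (A j * (1 + ‖w‖ + ‖z‖) ^ (Q k).natDegree) := by
        refine norm_sum_le_of_le _ fun j hj => ?_
        rw [norm_mul]
        gcongr
        exact hA j (Finset.mem_range.1 hj) z w
    _ = (∑ j ∈ Finset.range k, ‖c j‖ * A j) * (1 + ‖w‖ + ‖z‖) ^ (Q k).natDegree := by
        simp only [Finset.sum_mul, mul_assoc]
    _ ≤ e * (1 + ‖w‖ + ‖z‖) ^ (Q k).natDegree := by gcongr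

theorem contDiff_eval_mul_sub_pow (p : ℂ[X]) (i : ℕ) :
    ContDiff ℂ 1 fun x : ℂ × ℂ => p.eval x.2 * (x.2 - x.1) ^ i := by
  have hp : ContDiff ℂ 1 fun w : ℂ => p.eval w := by
    simpa only [coe_aeval_eq_eval] using p.contDiff_aeval (𝕜 := ℂ) 1
  exact (hp.comp contDiff_snd).mul ((contDiff_snd.sub contDiff_fst).pow i)

theorem eventually_norm_perturbation_sub_le (k : ℕ) (Q : ℕ → ℂ[X]) (R : ℝ) {e : ℝ} (he : 0 < e) :
    ∀ᶠ c in smallWeights k, ∀ x ∈ Metric.closedBall (0 : ℂ × ℂ) R,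
      ∀ y ∈ Metric.closedBall (0 : ℂ × ℂ) R,
        ‖perturbation k Q c x.1 x.2 - perturbation k Q c y.1 y.2‖ ≤ e * ‖x - y‖ := by
  have hterm (j : ℕ) : ∃ K : NNReal, LipschitzOnWith K
      (fun x : ℂ × ℂ => (Q j).eval x.2 * (x.2 - x.1) ^ (k - j)) (Metric.closedBall 0 R) :=
    (contDiff_eval_mul_sub_pow (Q j) (k - j)).restrict_scalars ℝ
      |>.contDiffOn.exists_lipschitzOnWith one_ne_zero (convex_closedBall _ _)
        (isCompact_closedBall _ _)
  choose K hK using hterm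
  filter_upwards [eventually_sum_norm_mul_le k (fun j => K j) he] with c hc x hx y hy
  calc ‖perturbation k Q c x.1 x.2 - perturbation k Q c y.1 y.2‖
      ≤ ∑ j ∈ Finset.range k, ‖c j‖ * (K j * ‖x - y‖) := by
        rw [perturbation, perturbation, ← Finset.sum_sub_distrib]
        refine norm_sum_le_of_le _ fun j _ => ?_
        rw [← mul_sub, norm_mul]
        gcongr
        exact (hK j).norm_sub_le hx hy
    _ = (∑ j ∈ Finset.range k, ‖c j‖ * K j) * ‖x - y‖ := by simp only [Finset.sum_mul, mul_assoc]
    _ ≤ e * ‖x - y‖ := by gcongr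

theorem NonDegenerate.coeff_mul_X_sub_C_pow (hT : NonDegenerate k Q) {j : ℕ} (hj : j ≤ k)
    (z : ℂ) : (Q j * (X - C z) ^ (k - j)).coeff (Q k).natDegree =
      (Q j).coeff ((Q k).natDegree - (k - j)) := by
  by_cases h0 : Q j = 0
  · simp [h0]
  have hle := hT.natDegree_add_le hj h0
  have hpow : ((X - C z) ^ (k - j)).natDegree = k - j := by
    rw [(monic_X_sub_C z).natDegree_pow, natDegree_X_sub_C, mul_one]
  have hcoeff := coeff_mul_add_eq_of_natDegree_le (f := Q j) (g := (X - C z) ^ (k - j))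
    (df := (Q k).natDegree - (k - j)) (dg := k - j) (by omega) hpow.le
  have hone := ((monic_X_sub_C z).pow (k - j)).coeff_natDegree
  rw [hpow] at hone
  rwa [Nat.sub_add_cancel (by omega), hone, mul_one] at hcoeff

theorem NonDegenerate.natDegree_weighted_le (hT : NonDegenerate k Q) (c : ℕ → ℂ) (z : ℂ) :
    (weighted k Q c z).natDegree ≤ (Q k).natDegree := by
  refine natDegree_sum_le_of_forall_le _ _ fun j hj => ?_
  by_cases h0 : Q j = 0
  · simp [h0]
  refine (natDegree_C_mul_le _ _).trans (natDegree_mul_le.trans ?_)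
  rw [(monic_X_sub_C z).natDegree_pow, natDegree_X_sub_C, mul_one]
  exact hT.natDegree_add_le (Nat.lt_succ_iff.1 (Finset.mem_range.1 hj)) h0

theorem NonDegenerate.eventually_natDegree_weighted_eq (hT : NonDegenerate k Q) :
    ∀ᶠ c in smallWeights k, ∀ z, (weighted k Q c z).natDegree = (Q k).natDegree := by
  let a (j : ℕ) : ℂ := (Q j).coeff ((Q k).natDegree - (k - j))
  have hcoeff (c : ℕ → ℂ) (z : ℂ) : (weighted k Q c z).coeff (Q k).natDegree =
      ∑ j ∈ Finset.range (k + 1), c j * a j := by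
    rw [weighted, finsetSum_coeff]
    refine Finset.sum_congr rfl fun j hj => ?_
    rw [coeff_C_mul, hT.coeff_mul_X_sub_C_pow (Nat.lt_succ_iff.1 (Finset.mem_range.1 hj))]
  have hlim : Tendsto (fun c : ℕ → ℂ => ∑ j ∈ Finset.range (k + 1), c j * a j) (smallWeights k)
      (𝓝 (Q k).leadingCoeff) := by
    have hsum := tendsto_finsetSum (Finset.range (k + 1)) fun j hj =>
      (tendsto_smallWeights_apply (Nat.lt_succ_iff.1 (Finset.mem_range.1 hj))).mul_const (a j)
    simpa [a] using hsum
  filter_upwards [hlim.eventually_ne (leadingCoeff_ne_zero.2 hT.1)] with c hc z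
  exact natDegree_eq_of_le_of_coeff_ne_zero (hT.natDegree_weighted_le c z) (hcoeff c z ▸ hc)

end Perturbation

section RootLocation

variable {k : ℕ} {Q : ℕ → ℂ[X]}

theorem leadingCoeff_mul_pow_le_norm_eval (p : ℂ[X]) {ρ : ℝ} (hρ : 0 ≤ ρ) {w : ℂ}
    (h : ∀ u, p.IsRoot u → ρ ≤ ‖w - u‖) : ‖p.leadingCoeff‖ * ρ ^ p.natDegree ≤ ‖p.eval w‖ := by
  have hs := IsAlgClosed.splits p
  have hprod : ‖(p.roots.map (w - ·)).prod‖ = (p.roots.map fun u => ‖w - u‖).prod :=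
    (map_multiset_prod (normHom : ℂ →*₀ ℝ) _).trans (by rw [Multiset.map_map]; rfl)
  rw [hs.eval_eq_prod_roots, norm_mul, hs.natDegree_eq_card_roots, hprod, ← Multiset.prod_replicate,
    ← Multiset.map_const']
  gcongr
  exact Multiset.prod_map_le_prod_map₀ _ _ (fun _ _ => hρ) fun u hu => h u (isRoot_of_mem_roots hu)

theorem exists_forall_isRoot_norm_le {p : ℂ[X]} (hp : p ≠ 0) :
    ∃ B : ℝ, ∀ u, p.IsRoot u → ‖u‖ ≤ B :=
  (p.finite_setOfPred_isRoot hp).isBounded.exists_norm_le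

theorem NonDegenerate.exists_eventually_norm_lt_max (hT : NonDegenerate k Q) :
    ∃ R₀ > 0, ∀ᶠ c in smallWeights k, ∀ z w, (weighted k Q c z).IsRoot w →
      ‖w‖ < max (‖z‖ / 2) R₀ := by
  have hlc : 0 < ‖(Q k).leadingCoeff‖ := norm_pos_iff.2 (leadingCoeff_ne_zero.2 hT.1)
  obtain ⟨B, hB⟩ := exists_forall_isRoot_norm_le hT.1
  obtain ⟨e, he, hlt⟩ := exists_pos_mul_lt hlc (8 ^ (Q k).natDegree)
  refine ⟨max 1 (2 * B), by positivity, ?_⟩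
  filter_upwards [hT.eventually_norm_perturbation_le he, eventually_smallWeights_top k]
    with c hc hck z w hw
  by_contra! hle
  obtain ⟨hz, hw1, hwB⟩ : ‖z‖ / 2 ≤ ‖w‖ ∧ 1 ≤ ‖w‖ ∧ 2 * B ≤ ‖w‖ := by
    simpa only [max_le_iff] using hle
  have hlow := leadingCoeff_mul_pow_le_norm_eval (Q k) (ρ := ‖w‖ / 2) (w := w) (by positivity)
    fun u hu => by linarith [norm_sub_norm_le w u, hB u hu]
  rw [IsRoot, eval_weighted_eq_add Q hck, add_eq_zero_iff_eq_neg] at hw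
  have hup : ‖(Q k).eval w‖ ≤ 8 ^ (Q k).natDegree * e * (‖w‖ / 2) ^ (Q k).natDegree :=
    calc ‖(Q k).eval w‖ = ‖perturbation k Q c z w‖ := by rw [hw, norm_neg]
      _ ≤ e * (1 + ‖w‖ + ‖z‖) ^ (Q k).natDegree := hc z w
      _ ≤ e * (8 * (‖w‖ / 2)) ^ (Q k).natDegree := by gcongr; linarith
      _ = _ := by rw [mul_pow]; ring
  exact hlt.not_ge (le_of_mul_le_mul_right (hlow.trans hup) (by positivity))

theorem NonDegenerate.eventually_exists_isRoot_mem_ball (hT : NonDegenerate k Q) (R : ℝ) {ρ : ℝ}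
    (hρ : 0 < ρ) : ∀ᶠ c in smallWeights k, ∀ z w, ‖z‖ ≤ R → ‖w‖ ≤ R → (weighted k Q c z).IsRoot w →
      ∃ u, (Q k).IsRoot u ∧ w ∈ Metric.ball u ρ := by
  have hlc : 0 < ‖(Q k).leadingCoeff‖ * ρ ^ (Q k).natDegree :=
    mul_pos (norm_pos_iff.2 (leadingCoeff_ne_zero.2 hT.1)) (pow_pos hρ _)
  obtain ⟨e, he, hlt⟩ := exists_pos_mul_lt hlc ((1 + R + R) ^ (Q k).natDegree)
  filter_upwards [hT.eventually_norm_perturbation_le he, eventually_smallWeights_top k]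
    with c hc hck z w hz hwR hw
  by_contra! hfar
  have hlow := leadingCoeff_mul_pow_le_norm_eval (Q k) hρ.le fun u hu => by
    simpa only [mem_ball_iff_norm, not_lt] using hfar u hu
  rw [IsRoot, eval_weighted_eq_add Q hck, add_eq_zero_iff_eq_neg] at hw
  have hup : ‖(Q k).eval w‖ ≤ (1 + R + R) ^ (Q k).natDegree * e :=
    calc ‖(Q k).eval w‖ = ‖perturbation k Q c z w‖ := by rw [hw, norm_neg]
      _ ≤ e * (1 + ‖w‖ + ‖z‖) ^ (Q k).natDegree := hc z w
      _ ≤ e * (1 + R + R) ^ (Q k).natDegree := by gcongr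
      _ = _ := mul_comm _ _
  exact hlt.not_ge (hlow.trans hup)

theorem eventually_expanding_near_isRoot {p : ℂ[X]} (hp : p.Separable) {u : ℂ} (hu : p.IsRoot u) :
    ∀ᶠ r in 𝓝[>] (0 : ℝ), ∀ w ∈ Metric.ball u r, ∀ w' ∈ Metric.ball u r,
      r * ‖w - w'‖ ≤ ‖p.eval w - p.eval w'‖ := by
  have hder : p.derivative.eval u ≠ 0 := hp.eval₂_derivative_ne_zero (RingHom.id ℂ) hu
  obtain ⟨C, hC, hbound⟩ := ((p.hasStrictDerivAt u).isTheta_sub hder).isBigO_symm.exists_pos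
  obtain ⟨δ, hδ, hball⟩ := Metric.eventually_nhds_iff_ball.1 hbound.bound
  filter_upwards [Ioo_mem_nhdsGT (lt_min hδ (inv_pos.2 hC))] with r hr w hw w' hw'
  obtain ⟨hrδ, hrC⟩ := lt_min_iff.1 hr.2
  have hle := hball (w, w') (by
    rw [← ball_prod_same]
    exact ⟨Metric.ball_subset_ball hrδ.le hw, Metric.ball_subset_ball hrδ.le hw'⟩)
  calc r * ‖w - w'‖ ≤ C⁻¹ * ‖w - w'‖ := by gcongr
    _ ≤ ‖p.eval w - p.eval w'‖ := (inv_mul_le_iff₀ hC).2 hle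

theorem eventually_expanding_near_roots {p : ℂ[X]} (hp : p.Separable) :
    ∀ᶠ r in 𝓝[>] (0 : ℝ), ∀ u, p.IsRoot u → ∀ w ∈ Metric.ball u r, ∀ w' ∈ Metric.ball u r,
      r * ‖w - w'‖ ≤ ‖p.eval w - p.eval w'‖ :=
  (p.finite_setOfPred_isRoot hp.ne_zero).eventually_all.2 fun _ hu =>
    eventually_expanding_near_isRoot hp hu

theorem separable_of_forall_rootMultiplicity_eq_one {p : ℂ[X]} (hp : p ≠ 0)
    (h : ∀ u, p.IsRoot u → p.rootMultiplicity u = 1) : p.Separable := by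
  refine (isCoprime_iff_aeval_ne_zero_of_isAlgClosed ℂ ℂ _ _).2 fun u => ?_
  by_contra! hu
  have := (one_lt_rootMultiplicity_iff_isRoot hp).2 hu
  exact this.ne' (h u hu.1)

end RootLocation

section TracksRoots

/-- The zeros of `F z`, for `‖z‖ ≤ R`, are simple perturbations of the zeros of `p`: they lie in
the discs of radius `ρ` about these, on which `F z` expands distances by `β`, while the values of
`F z` move at speed at most `β * q` in `z`. -/
structure TracksRoots (p : ℂ[X]) (F : ℂ → ℂ[X]) (R ρ β : ℝ) (q : NNReal) : Prop where
  pos : 0 < β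
  natDegree_eq : ∀ z, (F z).natDegree = p.natDegree
  near : ∀ z w, ‖z‖ ≤ R → (F z).IsRoot w → ∃ u, p.IsRoot u ∧ w ∈ Metric.ball u ρ
  expand : ∀ z u, ‖z‖ ≤ R → p.IsRoot u → ∀ w ∈ Metric.ball u ρ, ∀ w' ∈ Metric.ball u ρ,
    β * ‖w - w'‖ ≤ ‖(F z).eval w - (F z).eval w'‖
  lipschitz : ∀ z z' u, ‖z‖ ≤ R → ‖z'‖ ≤ R → p.IsRoot u → ∀ w ∈ Metric.ball u ρ,
    ‖(F z).eval w - (F z').eval w‖ ≤ β * q * ‖z - z'‖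

/-- The functions `f u`, indexed by the zeros `u` of `p`, are the branches on the disc of radius
`R` of the zeros of `F z`, each of them staying within `ρ` of `u`. -/
structure IsBranches (p : ℂ[X]) (F : ℂ → ℂ[X]) (R ρ : ℝ) (f : p.rootSet ℂ → ℂ → ℂ) : Prop where
  mem_ball : ∀ (u : p.rootSet ℂ) (z : ℂ), ‖z‖ ≤ R → f u z ∈ Metric.ball (u : ℂ) ρ
  roots_eq : ∀ z, ‖z‖ ≤ R → (F z).roots = Finset.univ.val.map fun u => f u z

variable {p : ℂ[X]} {F : ℂ → ℂ[X]} {R ρ β : ℝ} {q : NNReal} {f : p.rootSet ℂ → ℂ → ℂ}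

theorem isRoot_of_mem_rootSet {u : ℂ} (hu : u ∈ p.rootSet ℂ) : p.IsRoot u := by
  simpa using aeval_eq_zero_of_mem_rootSet hu

theorem IsBranches.isRoot (hf : IsBranches p F R ρ f) (u : p.rootSet ℂ) {z : ℂ} (hz : ‖z‖ ≤ R) :
    (F z).IsRoot (f u z) :=
  isRoot_of_mem_roots (hf.roots_eq z hz ▸ Multiset.mem_map_of_mem _ (Finset.mem_univ_val u))

theorem TracksRoots.derivative_ne_zero (h : TracksRoots p F R ρ β q) {z u w : ℂ} (hz : ‖z‖ ≤ R)
    (hu : p.IsRoot u) (hw : w ∈ Metric.ball u ρ) : (F z).derivative.eval w ≠ 0 := by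
  intro h0
  have hd := (F z).hasDerivAt w
  rw [h0, hasDerivAt_iff_isLittleO] at hd
  have hfalse : ∀ᶠ _ in 𝓝[≠] w, False := by
    filter_upwards [(hd.def (half_pos h.pos)).filter_mono nhdsWithin_le_nhds,
      mem_nhdsWithin_of_mem_nhds (Metric.isOpen_ball.mem_nhds hw), self_mem_nhdsWithin]
      with w' hsmall hball hne
    rw [smul_zero, sub_zero] at hsmall
    have hpos : 0 < β * ‖w' - w‖ := mul_pos h.pos (norm_pos_iff.2 (sub_ne_zero.2 hne))
    linarith [h.expand z u hz hu w' hball w hw]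
  simpa using hfalse.exists

theorem TracksRoots.separable (h : TracksRoots p F R ρ β q) {z : ℂ} (hz : ‖z‖ ≤ R) :
    (F z).Separable := by
  refine (isCoprime_iff_aeval_ne_zero_of_isAlgClosed ℂ ℂ _ _).2 fun w => ?_
  by_contra! hw
  obtain ⟨u, hu, hwu⟩ := h.near z w hz hw.1
  exact h.derivative_ne_zero hz hu hwu hw.2

theorem TracksRoots.exists_equiv_rootSet (h : TracksRoots p F R ρ β q) (hp : p.Separable) {z : ℂ}
    (hz : ‖z‖ ≤ R) :
    ∃ e : (F z).rootSet ℂ ≃ p.rootSet ℂ, ∀ w, (w : ℂ) ∈ Metric.ball (e w : ℂ) ρ := by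
  have hnear (w : (F z).rootSet ℂ) : ∃ u : p.rootSet ℂ, (w : ℂ) ∈ Metric.ball (u : ℂ) ρ := by
    obtain ⟨u, hu, hwu⟩ := h.near z w hz (isRoot_of_mem_rootSet w.2)
    exact ⟨⟨u, (mem_rootSet_of_ne hp.ne_zero).2 (by simpa using hu)⟩, hwu⟩
  choose g hg using hnear
  have hinj : Function.Injective g := fun w w' hww' => by
    have hle := h.expand z (g w) hz (isRoot_of_mem_rootSet (g w).2) w (hg w) w' (hww' ▸ hg w')
    rw [isRoot_of_mem_rootSet w.2, isRoot_of_mem_rootSet w'.2, sub_zero, norm_zero] at hle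
    exact Subtype.ext (sub_eq_zero.1 (norm_le_zero_iff.1 (nonpos_of_mul_nonpos_right hle h.pos)))
  have hcard : Fintype.card ((F z).rootSet ℂ) = Fintype.card (p.rootSet ℂ) := by
    rw [card_rootSet_eq_natDegree (h.separable hz) (IsAlgClosed.splits _), h.natDegree_eq z,
      card_rootSet_eq_natDegree hp (IsAlgClosed.splits _)]
  exact ⟨.ofBijective g ((Fintype.bijective_iff_injective_and_card g).2 ⟨hinj, hcard⟩), hg⟩

theorem TracksRoots.exists_isBranches (h : TracksRoots p F R ρ β q) (hp : p.Separable) :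
    ∃ f, IsBranches p F R ρ f := by
  have hex (z : ℂ) : ∃ g : p.rootSet ℂ → ℂ, ‖z‖ ≤ R →
      (∀ u : p.rootSet ℂ, g u ∈ Metric.ball (u : ℂ) ρ) ∧ (F z).roots = Finset.univ.val.map g := by
    by_cases hz : ‖z‖ ≤ R
    · obtain ⟨e, he⟩ := h.exists_equiv_rootSet hp hz
      refine ⟨fun u => e.symm u, fun _ => ⟨fun u => by simpa using he (e.symm u), ?_⟩⟩
      have hnodup : (Finset.univ.val.map fun u : p.rootSet ℂ => (e.symm u : ℂ)).Nodup :=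
        Finset.univ.nodup.map (Subtype.val_injective.comp e.symm.injective)
      refine (Multiset.Nodup.ext (nodup_roots (h.separable hz)) hnodup).2 fun w => ?_
      simp [e.symm.exists_congr_left, mem_rootSet]
    · exact ⟨0, fun h => absurd h hz⟩
  choose g hg using hex
  exact ⟨fun u z => g z u, fun u z hz => (hg z hz).1 u, fun z hz => (hg z hz).2⟩

theorem TracksRoots.lipschitzOnWith (h : TracksRoots p F R ρ β q) (hf : IsBranches p F R ρ f)
    (u : p.rootSet ℂ) : LipschitzOnWith q (f u) (Metric.closedBall 0 R) := by
  refine LipschitzOnWith.of_dist_le_mul fun z hz z' hz' => ?_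
  rw [mem_closedBall_zero_iff] at hz hz'
  have hu := isRoot_of_mem_rootSet u.2
  have hexp := h.expand z u hz hu _ (hf.mem_ball u z hz) _ (hf.mem_ball u z' hz')
  have hlip := h.lipschitz z z' u hz hz' hu _ (hf.mem_ball u z' hz')
  rw [(hf.isRoot u hz).eq_zero, zero_sub, norm_neg] at hexp
  rw [(hf.isRoot u hz').eq_zero, sub_zero, mul_assoc] at hlip
  rw [dist_eq_norm, dist_eq_norm]
  exact le_of_mul_le_mul_left (hexp.trans hlip) h.pos

theorem differentiableAt_of_eventually_eq {Φ : ℂ × ℂ → ℂ} {f : ℂ → ℂ} {z₀ a b : ℂ}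
    (hΦ : ContDiffAt ℂ 1 Φ (z₀, f z₀)) (ha : HasDerivAt (fun w => Φ (z₀, w)) a (f z₀))
    (ha0 : a ≠ 0) (hf : ContinuousAt f z₀) (heq : ∀ᶠ z in 𝓝 z₀, Φ (z, f z) = b) :
    DifferentiableAt ℂ f z₀ := by
  have hΦ' := hΦ.hasStrictFDerivAt one_ne_zero
  have hinv : (fderiv ℂ Φ (z₀, f z₀) ∘L .inr ℂ ℂ ℂ).IsInvertible := by
    have hpartial : fderiv ℂ Φ (z₀, f z₀) (0, 1) = a :=
      (hΦ'.hasFDerivAt.comp_hasDerivAt (f z₀)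
        ((hasDerivAt_const (f z₀) z₀).prodMk (hasDerivAt_id (f z₀)))).unique ha
    refine ⟨.unitsEquivAut ℂ (.mk0 a ha0), ContinuousLinearMap.ext_ring ?_⟩
    simp [hpartial]
  have himplicit := hΦ'.eventually_apply_eq_iff_implicitFunctionOfProdDomain hinv
  have hgraph : Tendsto (fun z => (z, f z)) (𝓝 z₀) (𝓝 (z₀, f z₀)) :=
    tendsto_id.prodMk_nhds hf
  refine ((hΦ'.hasStrictFDerivAt_implicitFunctionOfProdDomain hinv).hasFDerivAt
    |>.differentiableAt).congr_of_eventuallyEq ?_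
  filter_upwards [hgraph.eventually himplicit, heq] with z hz hzb
  exact (hz.1 (hzb.trans heq.self_of_nhds.symm)).symm

theorem TracksRoots.differentiableOn (h : TracksRoots p F R ρ β q) (hf : IsBranches p F R ρ f)
    (hF : ContDiff ℂ 1 fun x : ℂ × ℂ => (F x.1).eval x.2) (u : p.rootSet ℂ) :
    DifferentiableOn ℂ (f u) (Metric.ball 0 R) := fun z hz => by
  have hnhds : Metric.closedBall (0 : ℂ) R ∈ 𝓝 z :=
    mem_of_superset (Metric.isOpen_ball.mem_nhds hz) Metric.ball_subset_closedBall
  have hzR : ‖z‖ ≤ R := mem_closedBall_zero_iff.1 (Metric.ball_subset_closedBall hz)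
  refine (differentiableAt_of_eventually_eq hF.contDiffAt ((F z).hasDerivAt _)
    (h.derivative_ne_zero hzR (isRoot_of_mem_rootSet u.2) (hf.mem_ball u z hzR))
    ((h.lipschitzOnWith hf u).continuousOn.continuousAt hnhds)
    (b := 0) ?_).differentiableWithinAt
  filter_upwards [hnhds] with z' hz'
  exact hf.isRoot u (mem_closedBall_zero_iff.1 hz')

end TracksRoots

section TracksRootsWeighted

variable {k : ℕ} {Q : ℕ → ℂ[X]}

theorem contDiff_eval_weighted (k : ℕ) (Q : ℕ → ℂ[X]) (c : ℕ → ℂ) :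
    ContDiff ℂ 1 fun x : ℂ × ℂ => (weighted k Q c x.1).eval x.2 := by
  simp only [eval_weighted]
  exact ContDiff.sum fun j _ => contDiff_const.mul (contDiff_eval_mul_sub_pow (Q j) (k - j))

theorem eventually_norm_eval_weighted_sub_le (k : ℕ) (Q : ℕ → ℂ[X]) (R : ℝ) {e : ℝ} (he : 0 < e) :
    ∀ᶠ c in smallWeights k, ∀ z z' w, ‖z‖ ≤ R → ‖z'‖ ≤ R → ‖w‖ ≤ R →
      ‖(weighted k Q c z).eval w - (weighted k Q c z').eval w‖ ≤ e * ‖z - z'‖ := by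
  filter_upwards [eventually_norm_perturbation_sub_le k Q R he, eventually_smallWeights_top k]
    with c hc hck z z' w hz hz' hw
  have hle := hc (z, w) (by simp [Prod.norm_def, hz, hw]) (z', w) (by simp [Prod.norm_def, hz', hw])
  rw [eval_weighted_eq_add Q hck, eval_weighted_eq_add Q hck, add_sub_add_left_eq_sub]
  simpa [Prod.norm_def] using hle

theorem eventually_expanding_weighted (k : ℕ) (Q : ℕ → ℂ[X]) (R : ℝ) {β : ℝ} (hβ : 0 < β) :
    ∀ᶠ c in smallWeights k, ∀ z w w', ‖z‖ ≤ R → ‖w‖ ≤ R → ‖w'‖ ≤ R →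
      β * ‖w - w'‖ ≤ ‖(Q k).eval w - (Q k).eval w'‖ →
        β / 2 * ‖w - w'‖ ≤ ‖(weighted k Q c z).eval w - (weighted k Q c z).eval w'‖ := by
  filter_upwards [eventually_norm_perturbation_sub_le k Q R (half_pos hβ),
    eventually_smallWeights_top k] with c hc hck z w w' hz hw hw' hexp
  have hle : ‖perturbation k Q c z w - perturbation k Q c z w'‖ ≤ β / 2 * ‖w - w'‖ := by
    simpa [Prod.norm_def] using
      hc (z, w) (by simp [Prod.norm_def, hz, hw]) (z, w') (by simp [Prod.norm_def, hz, hw'])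
  rw [eval_weighted_eq_add Q hck, eval_weighted_eq_add Q hck, add_sub_add_comm]
  linarith [norm_sub_le_norm_add ((Q k).eval w - (Q k).eval w')
    (perturbation k Q c z w - perturbation k Q c z w')]

theorem NonDegenerate.exists_eventually_tracksRoots (hT : NonDegenerate k Q)
    (hsep : (Q k).Separable) {ε : ℝ} (hε : 0 < ε) {q : NNReal} (hq : 0 < q) :
    ∃ R > 0, ∃ ρ ≤ ε, ∃ β, ∀ᶠ c in smallWeights k,
      TracksRoots (Q k) (weighted k Q c) R ρ β q ∧
        ∀ z w, (weighted k Q c z).IsRoot w → ‖w‖ < max (‖z‖ / 2) R := by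
  obtain ⟨ρ, hexp, hρ, hρε⟩ :=
    ((eventually_expanding_near_roots hsep).and (Ioo_mem_nhdsGT hε)).exists
  obtain ⟨B, hB⟩ := exists_forall_isRoot_norm_le hT.1
  obtain ⟨R₀, hR₀, hnorm⟩ := hT.exists_eventually_norm_lt_max
  let R := max R₀ (B + ρ)
  have hR : 0 < R := lt_max_of_lt_left hR₀
  have hball {u w : ℂ} (hu : (Q k).IsRoot u) (hw : w ∈ Metric.ball u ρ) : ‖w‖ ≤ R := by
    rw [mem_ball_iff_norm] at hw
    exact le_max_of_le_right (by linarith [norm_sub_norm_le w u, hB u hu])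
  refine ⟨R, hR, ρ, hρε.le, ρ / 2, ?_⟩
  filter_upwards [hnorm, hT.eventually_natDegree_weighted_eq,
    hT.eventually_exists_isRoot_mem_ball R hρ, eventually_expanding_weighted k Q R hρ,
    eventually_norm_eval_weighted_sub_le k Q R (e := ρ / 2 * q) (by positivity)]
    with c hnorm hdeg hnear hexpand hlip
  have hlt (z w : ℂ) (hw : (weighted k Q c z).IsRoot w) : ‖w‖ < max (‖z‖ / 2) R :=
    (hnorm z w hw).trans_le (max_le_max_left _ (le_max_left _ _))
  refine ⟨⟨half_pos hρ, hdeg, fun z w hz hw => hnear z w hz ?_ hw,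
    fun z u hz hu w hw w' hw' => hexpand z w w' hz (hball hu hw) (hball hu hw')
      (hexp u hu w hw w' hw'),
    fun z z' u hz hz' hu w hw => hlip z z' w hz hz' (hball hu hw)⟩, hlt⟩
  exact (hlt z w hw).le.trans (max_le (by linarith) le_rfl)

end TracksRootsWeighted

section Infinitude

theorem subset_singleton_of_sum_sub_eq_zero {E : Type*} [NormedAddCommGroup E]
    [InnerProductSpace ℝ E] {t : Finset E} {w : E} (ht : ∀ z ∈ t, ‖z‖ ≤ ‖w‖)
    (hsum : ∑ z ∈ t, (w - z) = 0) : t ⊆ {w} := by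
  have hle : ∑ z ∈ t, ‖w - z‖ ^ 2 ≤ 0 :=
    calc ∑ z ∈ t, ‖w - z‖ ^ 2 ≤ ∑ z ∈ t, 2 * inner ℝ w (w - z) := by
          refine Finset.sum_le_sum fun z hz => ?_
          have hz2 : ‖z‖ ^ 2 ≤ ‖w‖ ^ 2 := pow_le_pow_left₀ (norm_nonneg z) (ht z hz) 2
          rw [norm_sub_sq_real, inner_sub_right, real_inner_self_eq_norm_sq]
          linarith
      _ = 0 := by rw [← Finset.mul_sum, ← inner_sum, hsum, inner_zero_right, mul_zero]
  have hzero := (Finset.sum_eq_zero_iff_of_nonneg fun z _ => sq_nonneg ‖w - z‖).1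
    (hle.antisymm (Finset.sum_nonneg fun z _ => sq_nonneg _))
  intro z hz
  rw [Finset.mem_singleton, eq_comm, ← sub_eq_zero, ← norm_eq_zero]
  exact pow_eq_zero_iff two_ne_zero |>.1 (hzero z hz)

theorem exists_subset_singleton_of_sum_sub_eq {E : Type*} [NormedAddCommGroup E]
    [InnerProductSpace ℝ E] {s : Finset E} (hs : s.Nonempty) {N : E → Finset E}
    (hN : ∀ w ∈ s, N w ⊆ s) {γ : E} (hsum : ∀ w ∈ s, ∑ z ∈ N w, (w - z) = γ) :
    ∃ w ∈ s, N w ⊆ {w} := by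
  have hγ : γ = 0 := by
    obtain ⟨w, hw, hmin⟩ := s.exists_min_image (fun w => inner ℝ γ w) hs
    rw [← real_inner_self_nonpos]
    calc inner ℝ γ γ = ∑ z ∈ N w, inner ℝ γ (w - z) := by rw [← inner_sum, hsum w hw]
      _ ≤ 0 := Finset.sum_nonpos fun z hz => by
        rw [inner_sub_right, sub_nonpos]
        exact hmin z (hN w hw hz)
  obtain ⟨w, hw, hmax⟩ := s.exists_max_image (fun w => ‖w‖) hs
  exact ⟨w, hw, subset_singleton_of_sum_sub_eq_zero (fun z hz => hmax z (hN w hw hz))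
    ((hsum w hw).trans hγ)⟩

theorem exists_subset_singleton_of_mul_sub_eq_sum {s : Finset ℂ} (hs : s.Nonempty)
    {N : ℂ → Finset ℂ} (hN : ∀ w ∈ s, N w ⊆ s) {κ b p : ℂ} {d : ℕ}
    (hcard : ∀ w ∈ s, (N w).card ≤ d) (hb : ‖κ‖ * (2 * d) < ‖b‖)
    (hsum : ∀ w ∈ s, b * (w - p) = κ * ∑ z ∈ N w, (w - z)) :
    ∃ w ∈ s, N w ⊆ {w} := by
  obtain ⟨w, hw, hmax⟩ := s.exists_max_image (fun w => ‖w - p‖) hs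
  have hdiff : ‖∑ z ∈ N w, (w - z)‖ ≤ d * (2 * ‖w - p‖) :=
    calc ‖∑ z ∈ N w, (w - z)‖ ≤ ∑ z ∈ N w, 2 * ‖w - p‖ := by
          refine norm_sum_le_of_le _ fun z hz => ?_
          rw [← sub_sub_sub_cancel_right w z p, two_mul]
          exact (norm_sub_le _ _).trans (add_le_add_right (hmax z (hN w hw hz)) _)
      _ ≤ d * (2 * ‖w - p‖) := by
          rw [Finset.sum_const, nsmul_eq_mul]
          gcongr
          exact hcard w hw
  have hle : ‖b‖ * ‖w - p‖ ≤ ‖κ‖ * (2 * d) * ‖w - p‖ :=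
    calc ‖b‖ * ‖w - p‖ = ‖κ‖ * ‖∑ z ∈ N w, (w - z)‖ := by rw [← norm_mul, hsum w hw, norm_mul]
      _ ≤ ‖κ‖ * (d * (2 * ‖w - p‖)) := by gcongr
      _ = ‖κ‖ * (2 * d) * ‖w - p‖ := by ring
  have hwp : ‖w - p‖ ≤ 0 := by
    by_contra! hpos
    exact hb.not_ge (le_of_mul_le_mul_right hle hpos)
  have heq (z : ℂ) (hz : z ∈ s) : z = p :=
    sub_eq_zero.1 (norm_le_zero_iff.1 ((hmax z hz).trans hwp))
  exact ⟨w, hw, fun z hz => Finset.mem_singleton.2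
    ((heq z (hN w hw hz)).trans (heq w hw).symm)⟩

theorem card_filter_rel_eq_of_le {α : Type*} {r : α → α → Prop} [∀ a b, Decidable (r a b)]
    {s : Finset α} {d : ℕ} (hr : ∀ a ∈ s, (s.filter (r a)).card = d)
    (hr' : ∀ b ∈ s, (s.filter (r · b)).card ≤ d) :
    ∀ b ∈ s, (s.filter (r · b)).card = d := by
  refine (Finset.sum_eq_sum_iff_of_le hr').1 ?_
  have hcount := Finset.sum_card_bipartiteAbove_eq_sum_card_bipartiteBelow (s := s) (t := s) r
  exact hcount.symm.trans (Finset.sum_congr rfl hr)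

variable {k : ℕ} {Q : ℕ → ℂ[X]} {c : ℕ → ℂ}

/-- For fixed `w`, the value of `weighted k Q c z` at `w` as a polynomial in `w - z`. -/
def cofibre (k : ℕ) (Q : ℕ → ℂ[X]) (c : ℕ → ℂ) (w : ℂ) : ℂ[X] :=
  ∑ i ∈ Finset.range (k + 1), C (c (k - i) * (Q (k - i)).eval w) * X ^ i

theorem coeff_cofibre (Q : ℕ → ℂ[X]) (c : ℕ → ℂ) (w : ℂ) {i : ℕ} (hi : i ≤ k) :
    (cofibre k Q c w).coeff i = c (k - i) * (Q (k - i)).eval w := by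
  simp_rw [cofibre, finsetSum_coeff, coeff_C_mul_X_pow]
  rw [Finset.sum_ite_eq, if_pos (Finset.mem_range.2 (Nat.lt_succ_iff.2 hi))]

theorem eval_cofibre (k : ℕ) (Q : ℕ → ℂ[X]) (c : ℕ → ℂ) (z w : ℂ) :
    (cofibre k Q c w).eval (w - z) = (weighted k Q c z).eval w := by
  rw [cofibre, eval_weighted, ← Finset.sum_range_reflect, eval_finsetSum]
  refine Finset.sum_congr rfl fun j hj => ?_
  have hj' := Finset.mem_range.1 hj
  rw [show k + 1 - 1 - j = k - j by omega, show k - (k - j) = j by omega]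
  simp [mul_assoc]

theorem isRoot_cofibre {z w : ℂ} :
    (cofibre k Q c w).IsRoot (w - z) ↔ (weighted k Q c z).IsRoot w := by
  rw [IsRoot, eval_cofibre, IsRoot]

theorem cofibre_ne_zero (hc : ∀ j ≤ k, c j ≠ 0) (hQ : ¬∃ a, ∀ j ≤ k, (Q j).eval a = 0) (w : ℂ) :
    cofibre k Q c w ≠ 0 := by
  intro h0
  refine hQ ⟨w, fun j hj => ?_⟩
  have hcoeff := coeff_cofibre Q c w (Nat.sub_le k j)
  rw [h0, coeff_zero, Nat.sub_sub_self hj] at hcoeff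
  exact (mul_eq_zero.1 hcoeff.symm).resolve_left (hc j hj)

theorem natDegree_cofibre_le (k : ℕ) (Q : ℕ → ℂ[X]) (c : ℕ → ℂ) (w : ℂ) :
    (cofibre k Q c w).natDegree ≤ k :=
  natDegree_sum_le_of_forall_le _ _ fun _ hi =>
    (natDegree_C_mul_X_pow_le _ _).trans (Nat.lt_succ_iff.1 (Finset.mem_range.1 hi))

theorem NonDegenerate.natDegree_le_sub (hT : NonDegenerate k Q) {j : ℕ} (hj : j ≤ k) :
    (Q j).natDegree ≤ (Q k).natDegree - (k - j) := by
  by_cases h0 : Q j = 0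
  · simp [h0]
  have := hT.natDegree_add_le hj h0
  omega

theorem NonDegenerate.natDegree_cofibre_le_natDegree (hT : NonDegenerate k Q) (c : ℕ → ℂ) (w : ℂ) :
    (cofibre k Q c w).natDegree ≤ (Q k).natDegree := by
  rw [natDegree_le_iff_coeff_eq_zero]
  intro i hi
  rcases le_or_gt i k with hik | hik
  · have hQ : Q (k - i) = 0 := by
      by_contra h0
      have := hT.natDegree_add_le (Nat.sub_le k i) h0
      omega
    rw [coeff_cofibre Q c w hik, hQ, eval_zero, mul_zero]
  · exact coeff_eq_zero_of_natDegree_lt ((natDegree_cofibre_le k Q c w).trans_lt hik)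

theorem finite_setOf_isRoot_weighted (hc : ∀ j ≤ k, c j ≠ 0)
    (hQ : ¬∃ a, ∀ j ≤ k, (Q j).eval a = 0) (w : ℂ) :
    {z | (weighted k Q c z).IsRoot w}.Finite := by
  have hfin := finite_setOfPred_isRoot (cofibre_ne_zero hc hQ w)
  refine (hfin.preimage (sub_right_injective (b := w)).injOn).subset fun z hz => ?_
  exact isRoot_cofibre.2 hz

section Vieta

variable {w : ℂ} {t : Finset ℂ}

theorem NonDegenerate.card_le_natDegree (hT : NonDegenerate k Q) (hw : cofibre k Q c w ≠ 0)
    (ht : ∀ z ∈ t, (weighted k Q c z).IsRoot w) : t.card ≤ (Q k).natDegree := by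
  classical
  rw [← Finset.card_image_of_injective t (sub_right_injective (b := w))]
  refine (card_le_degree_of_subset_roots fun x hx => ?_).trans
    (hT.natDegree_cofibre_le_natDegree c w)
  obtain ⟨z, hz, rfl⟩ := Finset.mem_image.1 hx
  exact (mem_roots hw).2 (isRoot_cofibre.2 (ht z hz))

theorem NonDegenerate.roots_cofibre_eq (hT : NonDegenerate k Q) (hw : cofibre k Q c w ≠ 0)
    (ht : ∀ z ∈ t, (weighted k Q c z).IsRoot w) (hcard : t.card = (Q k).natDegree) :
    (cofibre k Q c w).roots = t.val.map (w - ·) := by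
  classical
  refine (Multiset.eq_of_le_of_card_le ?_ ?_).symm
  · refine (Multiset.le_iff_subset (t.nodup.map sub_right_injective)).2 fun x hx => ?_
    obtain ⟨z, hz, rfl⟩ := Multiset.mem_map.1 hx
    exact (mem_roots hw).2 (isRoot_cofibre.2 (ht z hz))
  · rw [Multiset.card_map, Finset.card_val, hcard]
    exact (card_roots' _).trans (hT.natDegree_cofibre_le_natDegree c w)

theorem NonDegenerate.natDegree_cofibre_eq (hT : NonDegenerate k Q) (hw : cofibre k Q c w ≠ 0)
    (ht : ∀ z ∈ t, (weighted k Q c z).IsRoot w) (hcard : t.card = (Q k).natDegree) :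
    (cofibre k Q c w).natDegree = (Q k).natDegree := by
  rw [(IsAlgClosed.splits _).natDegree_eq_card_roots, hT.roots_cofibre_eq hw ht hcard,
    Multiset.card_map, Finset.card_val, hcard]

theorem NonDegenerate.eval_ne_zero (hT : NonDegenerate k Q) (hw : cofibre k Q c w ≠ 0)
    (ht : ∀ z ∈ t, (weighted k Q c z).IsRoot w) (hcard : t.card = (Q k).natDegree) {j : ℕ}
    (hj : j ≤ k) (hjk : (Q k).natDegree = k - j) : (Q j).eval w ≠ 0 := by
  have hlead := leadingCoeff_ne_zero.2 hw
  rw [leadingCoeff, hT.natDegree_cofibre_eq hw ht hcard, hjk, coeff_cofibre Q c w (Nat.sub_le k j),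
    Nat.sub_sub_self hj] at hlead
  exact right_ne_zero_of_mul hlead

theorem NonDegenerate.mul_eval_eq_neg_mul_sum_sub (hT : NonDegenerate k Q)
    (hw : cofibre k Q c w ≠ 0) (ht : ∀ z ∈ t, (weighted k Q c z).IsRoot w)
    (hcard : t.card = (Q k).natDegree) {j : ℕ} (hj : j < k) (hjk : (Q k).natDegree = k - j) :
    c (j + 1) * (Q (j + 1)).eval w = -(c j * (Q j).eval w) * ∑ z ∈ t, (w - z) := by
  have hdeg := (hT.natDegree_cofibre_eq hw ht hcard).trans hjk
  have hnext := (IsAlgClosed.splits (cofibre k Q c w)).nextCoeff_eq_neg_sum_roots_mul_leadingCoeff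
  rwa [nextCoeff_of_natDegree_pos (by omega), leadingCoeff, hdeg, hT.roots_cofibre_eq hw ht hcard,
    coeff_cofibre Q c w (Nat.sub_le k j), coeff_cofibre Q c w (by omega),
    Nat.sub_sub_self hj.le, show k - (k - j - 1) = j + 1 by omega] at hnext

end Vieta

theorem eventually_smallWeights_coeff (Q : ℕ → ℂ[X]) (k d : ℕ) :
    ∀ᶠ c in smallWeights k, ∀ j < k, (Q (j + 1)).coeff 1 ≠ 0 →
      ‖c j / c (j + 1) * (Q j).coeff 0‖ * (2 * d) < ‖(Q (j + 1)).coeff 1‖ := by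
  simp_rw [← Finset.mem_range]
  refine (eventually_all_finset _).2 fun j hj => ?_
  by_cases hb : (Q (j + 1)).coeff 1 = 0
  · exact .of_forall fun c hb' => absurd hb hb'
  have hlim := (((tendsto_smallWeights_div (Finset.mem_range.1 hj)).mul_const
    ((Q j).coeff 0)).norm).mul_const (2 * d : ℝ)
  rw [zero_mul, norm_zero, zero_mul] at hlim
  exact (hlim.eventually_lt_const (norm_pos_iff.2 hb)).mono fun c hc _ => hc

theorem NonDegenerate.exists_subset_singleton (hT : NonDegenerate k Q) (hd : 0 < (Q k).natDegree)
    (hc : ∀ j ≤ k, c j ≠ 0)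
    (hsmall : ∀ j < k, (Q (j + 1)).coeff 1 ≠ 0 →
      ‖c j / c (j + 1) * (Q j).coeff 0‖ * (2 * (Q k).natDegree) < ‖(Q (j + 1)).coeff 1‖)
    {s : Finset ℂ} (hs : s.Nonempty) {N : ℂ → Finset ℂ} (hN : ∀ w ∈ s, N w ⊆ s)
    (hw0 : ∀ w ∈ s, cofibre k Q c w ≠ 0) (hroot : ∀ w ∈ s, ∀ z ∈ N w, (weighted k Q c z).IsRoot w)
    (hcard : ∀ w ∈ s, (N w).card = (Q k).natDegree) : ∃ w ∈ s, N w ⊆ {w} := by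
  obtain ⟨w₀, hw₀⟩ := hs
  obtain ⟨j, hj, hjk⟩ : ∃ j < k, (Q k).natDegree = k - j := by
    have := natDegree_cofibre_le k Q c w₀
    have := hT.natDegree_cofibre_eq (hw0 w₀ hw₀) (hroot w₀ hw₀) (hcard w₀ hw₀)
    exact ⟨k - (Q k).natDegree, by omega, by omega⟩
  have hconst : (Q j).natDegree = 0 := by have := hT.natDegree_le_sub hj.le; omega
  have hlinear : (Q (j + 1)).natDegree ≤ 1 := (hT.natDegree_le_sub hj).trans (by omega)
  set a := (Q j).coeff 0
  set b := (Q (j + 1)).coeff 1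
  set e := (Q (j + 1)).coeff 0
  set κ := -(c j / c (j + 1) * a) with hκ_def
  have heval (w : ℂ) : (Q j).eval w = a := by rw [eq_C_of_natDegree_eq_zero hconst, eval_C]
  have hκ : κ ≠ 0 := by
    have ha := hT.eval_ne_zero (hw0 w₀ hw₀) (hroot w₀ hw₀) (hcard w₀ hw₀) hj.le hjk
    rw [heval] at ha
    exact neg_ne_zero.2 (mul_ne_zero (div_ne_zero (hc j hj.le) (hc _ hj)) ha)
  have hsum (w : ℂ) (hw : w ∈ s) : b * w + e = κ * ∑ z ∈ N w, (w - z) := by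
    have hvieta := hT.mul_eval_eq_neg_mul_sum_sub (hw0 w hw) (hroot w hw) (hcard w hw) hj hjk
    rw [heval, eq_X_add_C_of_natDegree_le_one hlinear] at hvieta
    simp only [eval_add, eval_mul, eval_C, eval_X] at hvieta
    have := hc (j + 1) hj
    rw [hκ_def]
    field_simp
    linear_combination hvieta
  by_cases hb : b = 0
  · refine exists_subset_singleton_of_sum_sub_eq ⟨w₀, hw₀⟩ hN (γ := e / κ) fun w hw => ?_
    rw [eq_div_iff hκ, mul_comm, ← hsum w hw, hb, zero_mul, zero_add]
  · refine exists_subset_singleton_of_mul_sub_eq_sum ⟨w₀, hw₀⟩ hN (b := b) (κ := κ) (p := -(e / b))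
      (fun w hw => (hcard w hw).le) ?_ fun w hw => ?_
    · rw [norm_neg]
      exact hsmall j hj hb
    rw [← hsum w hw]
    field_simp
    ring

theorem NonDegenerate.eventually_infinite_of_invariant (hT : NonDegenerate k Q)
    (hd : 2 ≤ (Q k).natDegree) (hQ : ¬∃ a, ∀ j ≤ k, (Q j).eval a = 0) :
    ∀ᶠ c in smallWeights k, ∀ S : Set ℂ, S.Nonempty → (∀ z ∈ S, (weighted k Q c z).Separable) →
      (∀ z ∈ S, ∀ w, (weighted k Q c z).IsRoot w → w ∈ S) → S.Infinite := by
  classical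
  filter_upwards [eventually_smallWeights_ne_zero k, hT.eventually_natDegree_weighted_eq,
    eventually_smallWeights_coeff Q k (Q k).natDegree] with c hc hdeg hsmall S hne hsep hinv hfin
  lift S to Finset ℂ using hfin
  have hcofibre := cofibre_ne_zero hc hQ
  have hout : ∀ z ∈ S, (S.filter ((weighted k Q c z).IsRoot ·)).card = (Q k).natDegree := by
    intro z hz
    have hroots : S.filter ((weighted k Q c z).IsRoot ·) = (weighted k Q c z).roots.toFinset := by
      ext w
      rw [Finset.mem_filter, Multiset.mem_toFinset, mem_roots (hsep z hz).ne_zero]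
      exact and_iff_right_of_imp (hinv z hz w)
    rw [hroots, Multiset.toFinset_card_of_nodup (nodup_roots (hsep z hz)), ← hdeg z,
      (IsAlgClosed.splits _).natDegree_eq_card_roots]
  have hin := card_filter_rel_eq_of_le hout fun w _ =>
    hT.card_le_natDegree (hcofibre w) fun z hz => (Finset.mem_filter.1 hz).2
  obtain ⟨w, hw, hsub⟩ := hT.exists_subset_singleton (by omega) hc hsmall hne
    (fun w _ => Finset.filter_subset _ _) (fun w _ => hcofibre w)
    (fun w _ z hz => (Finset.mem_filter.1 hz).2) hin
  have := Finset.card_le_card hsub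
  rw [hin w hw, Finset.card_singleton] at this
  omega

end Infinitude

/-! ### Correspondences with contracting branches -/

section Graph

theorem continuous_evalEval (P : ℂ[X][Y]) : Continuous fun p : ℂ × ℂ => P.evalEval p.1 p.2 := by
  have hexpand : (fun p : ℂ × ℂ => P.evalEval p.1 p.2) = fun p =>
      ∑ i ∈ Finset.range (P.natDegree + 1), (P.coeff i).eval p.1 * p.2 ^ i := by
    ext p
    simp [evalEval, eval_eq_sum_range (p := P), eval_finsetSum]
  rw [hexpand]
  exact continuous_finsetSum _ fun i _ =>
    ((P.coeff i).continuous.comp continuous_fst).mul (continuous_snd.pow i)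

theorem coe_mem_image_coe_iff {P : ℂ[X][Y]} {z w : ℂ} :
    (w : OnePoint ℂ) ∈ image P z ↔ P.evalEval z w = 0 := by
  let e : ℂ × ℂ → OnePoint ℂ × OnePoint ℂ := Prod.map (fun z => (z : OnePoint ℂ)) fun w => w
  have he : IsOpenEmbedding e := OnePoint.isOpenEmbedding_coe.prodMap OnePoint.isOpenEmbedding_coe
  let Γ : Set (ℂ × ℂ) := {p | P.evalEval p.1 p.2 = 0}
  have hgraph : graph P = closure (e '' Γ) := by
    refine congrArg closure (Set.ext fun p => ⟨?_, ?_⟩)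
    · rintro ⟨z, w, rfl, h0⟩
      exact ⟨(z, w), h0, rfl⟩
    · rintro ⟨⟨z, w⟩, h0, rfl⟩
      exact ⟨z, w, rfl, h0⟩
  have hclosed : IsClosed Γ := isClosed_eq (continuous_evalEval P) continuous_const
  change e (z, w) ∈ graph P ↔ (z, w) ∈ Γ
  rw [hgraph, ← Set.mem_preimage, ← he.isInducing.closure_eq_preimage_closure_image,
    hclosed.closure_eq]

theorem infty_notMem_image_coe {P : ℂ[X][Y]} {z : ℂ} {B : ℝ}
    (hB : ∀ᶠ z' in 𝓝 z, ∀ w, P.evalEval z' w = 0 → ‖w‖ ≤ B) :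
    OnePoint.infty ∉ image P (z : OnePoint ℂ) := by
  intro hmem
  have hfst : ∀ᶠ x : OnePoint ℂ in 𝓝 (z : OnePoint ℂ), ∀ z' : ℂ, x = z' →
      ∀ w, P.evalEval z' w = 0 → ‖w‖ ≤ B := by
    rw [OnePoint.nhds_coe_eq, eventually_map]
    exact hB.mono fun a ha z' h => OnePoint.coe_injective h ▸ ha
  have hsnd : ((fun w : ℂ => (w : OnePoint ℂ)) '' Metric.closedBall 0 B)ᶜ ∈
      𝓝 (OnePoint.infty : OnePoint ℂ) :=
    (OnePoint.isClosed_image_coe.2 ⟨Metric.isClosed_closedBall, isCompact_closedBall 0 B⟩)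
      |>.isOpen_compl.mem_nhds fun ⟨w, _, hw⟩ => OnePoint.coe_ne_infty w hw
  obtain ⟨_, ⟨hbound, hlarge⟩, z', w, rfl, h0⟩ :=
    mem_closure_iff_nhds.1 hmem _ (prod_mem_nhds hfst hsnd)
  exact hlarge ⟨w, mem_closedBall_zero_iff.2 (hbound z' rfl w h0), rfl⟩

theorem iterFibre_succ' (P : ℂ[X][Y]) (m : ℕ) (a : OnePoint ℂ) :
    iterFibre P (m + 1) a = (fibre P a).bind (iterFibre P m) := by
  induction m with
  | zero =>
    change ({a} : Multiset (OnePoint ℂ)).bind (fibre P) = (fibre P a).bind fun x => {x}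
    rw [Multiset.singleton_bind, Multiset.bind_singleton, Multiset.map_id']
  | succ m ih =>
    rw [iterFibre, ih, Multiset.bind_assoc]
    rfl

theorem iterFibre_add (P : ℂ[X][Y]) (m l : ℕ) (a : OnePoint ℂ) :
    iterFibre P (m + l) a = (iterFibre P m a).bind (iterFibre P l) := by
  induction l with
  | zero =>
    change iterFibre P m a = (iterFibre P m a).bind fun x => {x}
    rw [Multiset.bind_singleton, Multiset.map_id']
  | succ l ih => rw [← add_assoc, iterFibre, ih, Multiset.bind_assoc]; rfl

theorem natDegree_eq_of_forall_natDegree_map {P : ℂ[X][Y]} {d : ℕ}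
    (h : ∀ a, (P.map (evalRingHom a)).natDegree = d) : P.natDegree = d := by
  rcases eq_or_ne P 0 with rfl | hP
  · simpa using h 0
  obtain ⟨a, ha⟩ : ∃ a, P.leadingCoeff.eval a ≠ 0 := by
    by_contra! hzero
    exact leadingCoeff_ne_zero.2 hP (funext fun a => by simp [hzero a])
  rw [← h a, natDegree_map_of_leadingCoeff_ne_zero _ ha]

/-- The set `S` is closed, non-empty, and contains with `z` all zeros `w` of `P(z, w)`. -/
def ZeroInvariant (P : ℂ[X][Y]) (S : Set ℂ) : Prop :=
  IsClosed S ∧ S.Nonempty ∧ ∀ z ∈ S, ∀ w, P.evalEval z w = 0 → w ∈ S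

theorem zeroInvariant_preimage_coe {P : ℂ[X][Y]} {K : Set (OnePoint ℂ)} (hK : IsClosed K)
    (hinv : ForwardInvariant P K) (hne : ∃ a : ℂ, (a : OnePoint ℂ) ∈ K) :
    ZeroInvariant P ((fun z : ℂ => (z : OnePoint ℂ)) ⁻¹' K) :=
  ⟨hK.preimage OnePoint.continuous_coe, hne,
    fun z hz _ hw => hinv z hz (coe_mem_image_coe_iff.2 hw)⟩

end Graph

/-- All fibres of the correspondence over `ℂ` have `|ι|` points. Over the disc of radius `R` they
are given by the single-valued branches `f i`, which are contractions into the disc, and the images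
of points outside of it are half as large. -/
structure HasContractingBranches (P : ℂ[X][Y]) {ι : Type*} [Fintype ι] (f : ι → ℂ → ℂ) (R : ℝ)
    (q : NNReal) : Prop where
  pos : 0 < R
  natDegree_map : ∀ a, (P.map (evalRingHom a)).natDegree = Fintype.card ι
  norm_lt : ∀ z w, P.evalEval z w = 0 → ‖w‖ < max (‖z‖ / 2) R
  roots_eq : ∀ z, ‖z‖ ≤ R → (P.map (evalRingHom z)).roots = Finset.univ.val.map fun i => f i z
  lipschitz : ∀ i, LipschitzOnWith q (f i) (Metric.closedBall 0 R)
  differentiable : ∀ i, DifferentiableOn ℂ (f i) (Metric.ball 0 R)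
  lt_one : q < 1

namespace HasContractingBranches

variable {P : ℂ[X][Y]} {ι : Type*} [Fintype ι] {f : ι → ℂ → ℂ} {R : ℝ} {q : NNReal}

section Fibres

theorem natDegree_eq (h : HasContractingBranches P f R q) : P.natDegree = Fintype.card ι :=
  natDegree_eq_of_forall_natDegree_map h.natDegree_map

theorem image_coe (h : HasContractingBranches P f R q) (z : ℂ) :
    image P (z : OnePoint ℂ) = (fun w : ℂ => (w : OnePoint ℂ)) '' {w | P.evalEval z w = 0} := by
  have hinfty : OnePoint.infty ∉ image P (z : OnePoint ℂ) := by
    have hlim : Tendsto (fun z' : ℂ => max (‖z'‖ / 2) R) (𝓝 z) (𝓝 (max (‖z‖ / 2) R)) :=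
      ((continuous_norm.div_const 2).max continuous_const).tendsto z
    refine infty_notMem_image_coe (B := max (‖z‖ / 2) R + 1) ?_
    filter_upwards [hlim.eventually_le_const (lt_add_one _)] with z' hz' w hw
    exact (h.norm_lt z' w hw).le.trans hz'
  ext w
  induction w using OnePoint.rec with
  | infty => simp [hinfty]
  | coe w =>
    rw [coe_mem_image_coe_iff, OnePoint.coe_injective.mem_set_image]
    rfl

theorem card_roots_map (h : HasContractingBranches P f R q) (a : ℂ) :
    (P.map (evalRingHom a)).roots.card = Fintype.card ι := by
  rw [← (IsAlgClosed.splits _).natDegree_eq_card_roots, h.natDegree_map]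

theorem fibre_coe (h : HasContractingBranches P f R q) (a : ℂ) :
    fibre P (a : OnePoint ℂ) =
      (P.map (evalRingHom a)).roots.map fun w : ℂ => (w : OnePoint ℂ) := by
  have hdeg : P.natDegree - (slice P (a : OnePoint ℂ)).natDegree = 0 := by
    change P.natDegree - (P.map (evalRingHom a)).natDegree = 0
    rw [h.natDegree_eq, h.natDegree_map, Nat.sub_self]
  rw [fibre, hdeg, Multiset.replicate_zero, add_zero]
  rfl

variable [Nonempty ι]

theorem map_ne_zero (h : HasContractingBranches P f R q) (z : ℂ) : P.map (evalRingHom z) ≠ 0 :=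
  ne_zero_of_natDegree_gt (n := 0) (h.natDegree_map z ▸ Fintype.card_pos)

theorem mem_roots_iff (h : HasContractingBranches P f R q) (z w : ℂ) :
    w ∈ (P.map (evalRingHom z)).roots ↔ P.evalEval z w = 0 := by
  rw [mem_roots (h.map_ne_zero z), IsRoot, eval_map, eval₂_evalRingHom]

theorem exists_evalEval_eq_zero (h : HasContractingBranches P f R q) (z : ℂ) :
    ∃ w, P.evalEval z w = 0 := by
  obtain ⟨w, hw⟩ := Multiset.card_pos_iff_exists_mem.1
    ((h.card_roots_map z).symm ▸ Fintype.card_pos)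
  exact ⟨w, (h.mem_roots_iff z w).1 hw⟩

theorem evalEval_eq_zero_iff (h : HasContractingBranches P f R q) {z : ℂ} (hz : ‖z‖ ≤ R) (w : ℂ) :
    P.evalEval z w = 0 ↔ ∃ i, f i z = w := by
  rw [← h.mem_roots_iff, h.roots_eq z hz]
  simp

theorem evalEval_branch (h : HasContractingBranches P f R q) {z : ℂ} (hz : ‖z‖ ≤ R) (i : ι) :
    P.evalEval z (f i z) = 0 :=
  (h.evalEval_eq_zero_iff hz _).2 ⟨i, rfl⟩

theorem mapsTo_closedBall_ball (h : HasContractingBranches P f R q) (i : ι) :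
    Set.MapsTo (f i) (Metric.closedBall 0 R) (Metric.ball 0 R) := by
  intro z hz
  rw [mem_closedBall_zero_iff] at hz
  have hlt := h.norm_lt z (f i z) (h.evalEval_branch hz i)
  rwa [max_eq_right (by linarith [norm_nonneg z]), ← mem_ball_zero_iff] at hlt

theorem mapsTo_closedBall (h : HasContractingBranches P f R q) (i : ι) :
    Set.MapsTo (f i) (Metric.closedBall 0 R) (Metric.closedBall 0 R) :=
  (h.mapsTo_closedBall_ball i).mono_right Metric.ball_subset_closedBall

theorem mapsTo_ball (h : HasContractingBranches P f R q) (i : ι) :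
    Set.MapsTo (f i) (Metric.ball 0 R) (Metric.ball 0 R) :=
  (h.mapsTo_closedBall_ball i).mono_left Metric.ball_subset_closedBall

end Fibres

section Absorption

theorem norm_le_max_half (h : HasContractingBranches P f R q) {z w : ℂ} {r : ℝ}
    (hz : ‖z‖ ≤ max r R) (hw : P.evalEval z w = 0) : ‖w‖ ≤ max (r / 2) R := by
  refine (h.norm_lt z w hw).le.trans (max_le ?_ (le_max_right _ _))
  have hR := h.pos
  rcases le_max_iff.1 hz with hz | hz
  · exact le_max_of_le_left (by linarith)
  · exact le_max_of_le_right (by linarith)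

theorem exists_div_two_pow_le (h : HasContractingBranches P f R q) (r : ℝ) :
    ∃ m : ℕ, max (r / 2 ^ m) R = R := by
  obtain ⟨m, hm⟩ := pow_unbounded_of_one_lt (r / R) (one_lt_two (α := ℝ))
  rw [div_lt_iff₀ h.pos, ← div_lt_iff₀' (by positivity)] at hm
  exact ⟨m, max_eq_right hm.le⟩

variable [Nonempty ι]

theorem exists_coe_of_mem_iterFibre (h : HasContractingBranches P f R q) (a : ℂ) (m : ℕ) :
    ∀ x ∈ iterFibre P m a, ∃ w : ℂ, (w : OnePoint ℂ) = x ∧ ‖w‖ ≤ max (‖a‖ / 2 ^ m) R := by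
  induction m with
  | zero => simp [iterFibre]
  | succ m ih =>
    intro x hx
    obtain ⟨v, hv, hx⟩ := Multiset.mem_bind.1 hx
    obtain ⟨z, rfl, hz⟩ := ih v hv
    rw [h.fibre_coe, Multiset.mem_map] at hx
    obtain ⟨w, hw, rfl⟩ := hx
    rw [pow_succ, ← div_div]
    exact ⟨w, rfl, h.norm_le_max_half hz ((h.mem_roots_iff z w).1 hw)⟩

theorem card_iterFibre (h : HasContractingBranches P f R q) (a : ℂ) (m : ℕ) :
    (iterFibre P m a).card = Fintype.card ι ^ m := by
  induction m with
  | zero => rfl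
  | succ m ih =>
    have hcard (x : OnePoint ℂ) (hx : x ∈ iterFibre P m a) :
        (Multiset.card ∘ fibre P) x = Fintype.card ι := by
      obtain ⟨z, rfl, -⟩ := h.exists_coe_of_mem_iterFibre a m x hx
      rw [Function.comp_apply, h.fibre_coe, Multiset.card_map, h.card_roots_map]
    rw [iterFibre, Multiset.card_bind, Multiset.map_congr rfl hcard, Multiset.map_const',
      Multiset.sum_replicate, ih, smul_eq_mul, pow_succ]

theorem exists_mem_norm_le (h : HasContractingBranches P f R q) {S : Set ℂ}
    (hS : ZeroInvariant P S) : ∃ w ∈ S, ‖w‖ ≤ R := by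
  obtain ⟨-, ⟨a, ha⟩, hinv⟩ := hS
  have hmem (m : ℕ) : ∃ w ∈ S, ‖w‖ ≤ max (‖a‖ / 2 ^ m) R := by
    induction m with
    | zero => exact ⟨a, ha, by simp⟩
    | succ m ih =>
      obtain ⟨z, hz, hnorm⟩ := ih
      obtain ⟨w, hw⟩ := h.exists_evalEval_eq_zero z
      rw [pow_succ, ← div_div]
      exact ⟨w, hinv z hz w hw, h.norm_le_max_half hnorm hw⟩
  obtain ⟨m, hm⟩ := h.exists_div_two_pow_le ‖a‖
  exact hm ▸ hmem m

end Absorption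

section PeriodicPoints

theorem pow_length_lt_one (h : HasContractingBranches P f R q) {l : List ι} (hl : l ≠ []) :
    q ^ l.length < 1 :=
  pow_lt_one₀ zero_le h.lt_one (by simpa using hl)

variable [Nonempty ι]

theorem wordMap_mem_iterImage (h : HasContractingBranches P f R q) (l : List ι) {x : ℂ}
    (hx : x ∈ Metric.ball 0 R) :
    ((IFS.wordMap f l x : ℂ) : OnePoint ℂ) ∈ iterImage P l.length x := by
  induction l with
  | nil => rfl
  | cons i l ih =>
    refine ⟨_, ih, coe_mem_image_coe_iff.2 (h.evalEval_branch ?_ i)⟩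
    exact (mem_ball_zero_iff.1 (IFS.mapsTo_wordMap h.mapsTo_ball l hx)).le

theorem differentiableOn_wordMap (h : HasContractingBranches P f R q) (l : List ι) :
    DifferentiableOn ℂ (IFS.wordMap f l) (Metric.ball 0 R) := by
  induction l with
  | nil => exact differentiableOn_id
  | cons i l ih => exact (h.differentiable i).comp ih (IFS.mapsTo_wordMap h.mapsTo_ball l)

theorem lipschitzOnWith_wordMap (h : HasContractingBranches P f R q) (l : List ι) :
    LipschitzOnWith (q ^ l.length) (IFS.wordMap f l) (Metric.closedBall 0 R) :=
  IFS.lipschitzOnWith_wordMap h.lipschitz h.mapsTo_closedBall l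

theorem isAttractingPeriodic_of_wordMap_eq (h : HasContractingBranches P f R q) {l : List ι}
    (hl : l ≠ []) {x : ℂ} (hx : x ∈ Metric.ball 0 R) (hfix : IFS.wordMap f l x = x) :
    IsAttractingPeriodic P x := by
  have hball : Metric.ball (0 : ℂ) R ∈ 𝓝 x := Metric.isOpen_ball.mem_nhds hx
  refine ⟨l.length, List.length_pos_iff.2 hl, IFS.wordMap f l,
    (h.differentiableOn_wordMap l).analyticAt hball, ?_, hfix, ?_⟩
  · filter_upwards [hball] with y hy
    exact h.wordMap_mem_iterImage l hy
  · refine (norm_deriv_le_of_lipschitzOn (mem_of_superset hball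
      Metric.ball_subset_closedBall) (h.lipschitzOnWith_wordMap l)).trans_lt ?_
    exact_mod_cast h.pow_length_lt_one hl

theorem exists_wordMap_eq_self (h : HasContractingBranches P f R q) {l : List ι} (hl : l ≠ []) :
    ∃ x ∈ Metric.ball 0 R, IFS.wordMap f l x = x := by
  have hmaps : Set.MapsTo (IFS.wordMap f l) (Metric.closedBall 0 R) (Metric.closedBall 0 R) :=
    IFS.mapsTo_wordMap h.mapsTo_closedBall l
  have hcontr : ContractingWith (q ^ l.length) (hmaps.restrict _ _ _) :=
    ⟨h.pow_length_lt_one hl, (h.lipschitzOnWith_wordMap l).mapsToRestrict hmaps⟩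
  obtain ⟨y, hy, hfix, -⟩ := hcontr.exists_fixedPoint' Metric.isClosed_closedBall.isComplete hmaps
    (Metric.mem_closedBall_self h.pos.le) (edist_ne_top _ _)
  refine ⟨y, ?_, hfix⟩
  cases l with
  | nil => exact absurd rfl hl
  | cons i l =>
    exact hfix.eq ▸ h.mapsTo_closedBall_ball i (IFS.mapsTo_wordMap h.mapsTo_closedBall l hy)

theorem exists_seq_isAttractingPeriodic (h : HasContractingBranches P f R q) {S : Set ℂ}
    (hSR : S ⊆ Metric.closedBall 0 R) (hS : IFS.IsSelfSimilar f S) {w : ℂ} (hw : w ∈ S) :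
    ∃ v : ℕ → ℂ, (∀ m, IsAttractingPeriodic P (v m)) ∧ Tendsto v atTop (𝓝 w) := by
  have hex (m : ℕ) :
      ∃ x, IsAttractingPeriodic P x ∧ dist x w ≤ (q : ℝ) ^ (m + 1) * (R + R) := by
    obtain ⟨l, hl, y, hy, rfl⟩ := hS.exists_wordMap_eq (m + 1) w hw
    have hl0 : l ≠ [] := List.ne_nil_of_length_eq_add_one hl
    obtain ⟨x, hx, hfix⟩ := h.exists_wordMap_eq_self hl0
    have hxR := Metric.ball_subset_closedBall hx
    refine ⟨x, h.isAttractingPeriodic_of_wordMap_eq hl0 hx hfix, ?_⟩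
    calc dist x (IFS.wordMap f l y) = dist (IFS.wordMap f l x) (IFS.wordMap f l y) := by rw [hfix]
      _ ≤ (q : ℝ) ^ (m + 1) * dist x y := by
        simpa [hl] using (h.lipschitzOnWith_wordMap l).dist_le_mul x hxR y (hSR hy)
      _ ≤ (q : ℝ) ^ (m + 1) * (R + R) := by
        gcongr
        exact (dist_triangle_right x y 0).trans (add_le_add hxR (hSR hy))
  choose v hperiodic hdist using hex
  refine ⟨v, hperiodic, tendsto_iff_dist_tendsto_zero.2
    (squeeze_zero (fun _ => dist_nonneg) hdist ?_)⟩
  have hlim := (tendsto_pow_atTop_nhds_zero_of_lt_one q.2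
    (by exact_mod_cast h.lt_one)).mul_const (R + R)
  rw [zero_mul] at hlim
  exact hlim.comp (tendsto_add_atTop_nat 1)

end PeriodicPoints

end HasContractingBranches

section Equidistribution

theorem support_map_of_isClosedEmbedding {X Z : Type*} [TopologicalSpace X]
    [SecondCountableTopology X] [MeasurableSpace X] [BorelSpace X] [TopologicalSpace Z]
    [MeasurableSpace Z] [BorelSpace Z] {j : X → Z} (hj : IsClosedEmbedding j) (ν : Measure X) :
    (ν.map j).support = j '' ν.support := by
  have hjm := hj.measurableEmbedding
  apply Set.Subset.antisymm
  · refine Measure.support_subset_of_isClosed (hj.isClosedMap _ Measure.isClosed_support) ?_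
    rw [mem_ae_iff, hjm.map_apply, Set.preimage_compl, Set.preimage_image_eq _ hj.injective]
    exact Measure.measure_compl_support
  · rintro _ ⟨x, hx, rfl⟩
    rw [Measure.mem_support_iff_forall] at hx ⊢
    intro U hU
    rw [hjm.map_apply]
    exact hx _ (hj.continuous.continuousAt hU)

theorem integral_sum_dirac {X : Type*} [TopologicalSpace X] [MeasurableSpace X]
    [OpensMeasurableSpace X] (s : Multiset X) (φ : C(X, ℝ)) :
    ∫ x, φ x ∂(s.map Measure.dirac).sum = (s.map φ).sum := by
  have hdirac (a : X) : Integrable φ (Measure.dirac a) :=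
    integrable_dirac' φ.continuous.stronglyMeasurable (by simp)
  have hint (s : Multiset X) : Integrable φ (s.map Measure.dirac).sum := by
    induction s using Multiset.induction with
    | empty => simp
    | cons a s ih =>
      rw [Multiset.map_cons, Multiset.sum_cons]
      exact (hdirac a).add_measure ih
  induction s using Multiset.induction with
  | empty => simp
  | cons a s ih =>
    rw [Multiset.map_cons, Multiset.sum_cons, integral_add_measure (hdirac a) (hint s), ih,
      integral_dirac' _ _ φ.continuous.stronglyMeasurable, Multiset.map_cons, Multiset.sum_cons]

/-- The embedding of a closed disc into the sphere. -/
def discEmbedding (R : ℝ) : C(Metric.closedBall (0 : ℂ) R, OnePoint ℂ) :=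
  ⟨fun x => ((x : ℂ) : OnePoint ℂ), OnePoint.continuous_coe.comp continuous_subtype_val⟩

theorem isClosedEmbedding_discEmbedding (R : ℝ) : IsClosedEmbedding (discEmbedding R) :=
  (discEmbedding R).continuous.isClosedEmbedding
    (OnePoint.coe_injective.comp Subtype.val_injective)

theorem integral_map_discEmbedding {R : ℝ} (ν : Measure (Metric.closedBall (0 : ℂ) R))
    (φ : C(OnePoint ℂ, ℝ)) :
    ∫ x, φ x ∂(ν.map (discEmbedding R)) = ∫ x, φ.comp (discEmbedding R) x ∂ν :=
  (isClosedEmbedding_discEmbedding R).measurableEmbedding.integral_map φ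

/-- The support of a measure on a closed disc, as a set in the plane. For the equidistributed
measure of contracting branches it is their attractor. -/
def planeSupport {R : ℝ} (ν : Measure (Metric.closedBall (0 : ℂ) R)) : Set ℂ :=
  Subtype.val '' ν.support

variable {R : ℝ} {ν : Measure (Metric.closedBall (0 : ℂ) R)}

theorem image_coe_planeSupport (ν : Measure (Metric.closedBall (0 : ℂ) R)) :
    (fun z : ℂ => (z : OnePoint ℂ)) '' planeSupport ν = (ν.map (discEmbedding R)).support := by
  rw [support_map_of_isClosedEmbedding (isClosedEmbedding_discEmbedding R), planeSupport,
    Set.image_image]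
  rfl

theorem planeSupport_subset_closedBall : planeSupport ν ⊆ Metric.closedBall 0 R :=
  Subtype.coe_image_subset _ _

theorem isCompact_planeSupport : IsCompact (planeSupport ν) :=
  Measure.isClosed_support.isCompact.image continuous_subtype_val

end Equidistribution

namespace HasContractingBranches

variable {P : ℂ[X][Y]} {ι : Type*} [Fintype ι] [Nonempty ι] {f : ι → ℂ → ℂ} {R : ℝ} {q : NNReal}

section Pushforward

/-- The branches as continuous self-maps of the closed disc. -/
def branch (h : HasContractingBranches P f R q) (i : ι) :
    C(Metric.closedBall (0 : ℂ) R, Metric.closedBall (0 : ℂ) R) :=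
  ⟨(h.mapsTo_closedBall i).restrict _ _ _,
    (h.lipschitz i).continuousOn.mapsToRestrict (h.mapsTo_closedBall i)⟩

theorem lipschitzWith_branch (h : HasContractingBranches P f R q) (i : ι) :
    LipschitzWith q (h.branch i) :=
  (h.lipschitz i).mapsToRestrict (h.mapsTo_closedBall i)

theorem exists_equidistributes_branch (h : HasContractingBranches P f R q) :
    ∃ ν, IsProbabilityMeasure ν ∧ IFS.Equidistributes h.branch ν :=
  have : Nonempty (Metric.closedBall (0 : ℂ) R) := ⟨0, Metric.mem_closedBall_self h.pos.le⟩
  IFS.exists_equidistributes h.lt_one h.lipschitzWith_branch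

theorem fibre_discEmbedding (h : HasContractingBranches P f R q)
    (x : Metric.closedBall (0 : ℂ) R) :
    fibre P (discEmbedding R x) = Finset.univ.val.map fun i => discEmbedding R (h.branch i x) := by
  change fibre P ((x : ℂ) : OnePoint ℂ) = _
  rw [h.fibre_coe, h.roots_eq x (mem_closedBall_zero_iff.1 x.2), Multiset.map_map]
  rfl

theorem sum_iterFibre (h : HasContractingBranches P f R q) (φ : C(OnePoint ℂ, ℝ)) (m : ℕ) :
    ∀ x : Metric.closedBall (0 : ℂ) R, ((iterFibre P m (discEmbedding R x)).map φ).sum =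
      (Fintype.card ι : ℝ) ^ m * (IFS.transfer h.branch ^ m) (φ.comp (discEmbedding R)) x := by
  induction m with
  | zero => simp [iterFibre]
  | succ m ih =>
    intro x
    have hcard : (Fintype.card ι : ℝ) ≠ 0 := by exact_mod_cast Fintype.card_ne_zero
    rw [iterFibre_succ', h.fibre_discEmbedding, Multiset.bind_map, Multiset.map_bind,
      Multiset.sum_bind, IFS.transfer_pow_succ_apply', IFS.transfer_apply, pow_succ, mul_assoc,
      mul_inv_cancel_left₀ hcard, Finset.mul_sum]
    exact Finset.sum_congr rfl fun i _ => ih (h.branch i x)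

theorem sum_fibre (h : HasContractingBranches P f R q) (φ : C(OnePoint ℂ, ℝ))
    (x : Metric.closedBall (0 : ℂ) R) : ((fibre P (discEmbedding R x)).map φ).sum =
      Fintype.card ι * IFS.transfer h.branch (φ.comp (discEmbedding R)) x := by
  simpa [iterFibre] using h.sum_iterFibre φ 1 x

variable {ν : Measure (Metric.closedBall (0 : ℂ) R)}

theorem isPushforward_map (h : HasContractingBranches P f R q) [IsFiniteMeasure ν]
    (hν : IFS.Equidistributes h.branch ν) :
    IsPushforward P (ν.map (discEmbedding R))
      ((Fintype.card ι : ENNReal) • ν.map (discEmbedding R)) := by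
  have : Nonempty (Metric.closedBall (0 : ℂ) R) := ⟨0, Metric.mem_closedBall_self h.pos.le⟩
  have hjm := (isClosedEmbedding_discEmbedding R).measurableEmbedding
  intro φ
  have hfibre : (fun a => ((fibre P a).map φ).sum) ∘ discEmbedding R =
      fun x => Fintype.card ι * IFS.transfer h.branch (φ.comp (discEmbedding R)) x :=
    funext (h.sum_fibre φ)
  constructor
  · rw [hjm.integrable_map_iff, hfibre]
    exact ((IFS.transfer h.branch _).continuous.integrable_of_hasCompactSupport
      (HasCompactSupport.of_compactSpace _)).const_mul _
  · calc ∫ x, φ x ∂((Fintype.card ι : ENNReal) • ν.map (discEmbedding R))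
        = Fintype.card ι * ∫ x, φ.comp (discEmbedding R) x ∂ν := by
          rw [integral_smul_measure, integral_map_discEmbedding]
          simp
      _ = ∫ x, Fintype.card ι * IFS.transfer h.branch (φ.comp (discEmbedding R)) x ∂ν := by
          rw [integral_const_mul, hν.integral_transfer]
      _ = ∫ a, ((fibre P a).map φ).sum ∂(ν.map (discEmbedding R)) := by
          rw [hjm.integral_map]
          exact congrArg (fun g => ∫ x, g x ∂ν) hfibre.symm

theorem tendsto_sum_iterFibre (h : HasContractingBranches P f R q)
    (hν : IFS.Equidistributes h.branch ν) (φ : C(OnePoint ℂ, ℝ))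
    (x : Metric.closedBall (0 : ℂ) R) :
    Tendsto (fun m : ℕ => ((iterFibre P m (discEmbedding R x)).map φ).sum /
      (Fintype.card ι : ℝ) ^ m) atTop (𝓝 (∫ x, φ x ∂(ν.map (discEmbedding R)))) := by
  have hcard : (Fintype.card ι : ℝ) ≠ 0 := by exact_mod_cast Fintype.card_ne_zero
  simp_rw [integral_map_discEmbedding, h.sum_iterFibre,
    mul_div_cancel_left₀ _ (pow_ne_zero _ hcard)]
  exact hν _ x

theorem tendsto_pushDirac (h : HasContractingBranches P f R q)
    (hν : IFS.Equidistributes h.branch ν) (a : ℂ) (φ : C(OnePoint ℂ, ℝ)) :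
    Tendsto (fun m : ℕ => (1 / (Fintype.card ι : ℝ) ^ m) * ∫ x, φ x ∂(pushDirac P m a)) atTop
      (𝓝 (∫ x, φ x ∂(ν.map (discEmbedding R)))) := by
  have hd0 : (Fintype.card ι : ℝ) ≠ 0 := by exact_mod_cast Fintype.card_ne_zero
  set d : ℝ := (Fintype.card ι : ℝ) with hd
  obtain ⟨M, hM⟩ := h.exists_div_two_pow_le ‖a‖
  have hdisc (x : OnePoint ℂ) (hx : x ∈ iterFibre P M a) :
      Tendsto (fun m : ℕ => ((iterFibre P m x).map φ).sum / d ^ m) atTop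
        (𝓝 (∫ x, φ x ∂(ν.map (discEmbedding R)))) := by
    obtain ⟨w, rfl, hw⟩ := h.exists_coe_of_mem_iterFibre a M x hx
    exact h.tendsto_sum_iterFibre hν φ ⟨w, mem_closedBall_zero_iff.2 (hM ▸ hw)⟩
  have hsum := (tendsto_multiset_sum _ hdisc).div_const (d ^ M)
  rw [Multiset.map_const', Multiset.sum_replicate, h.card_iterFibre, nsmul_eq_mul, Nat.cast_pow,
    ← hd, mul_div_cancel_left₀ _ (pow_ne_zero _ hd0)] at hsum
  rw [← tendsto_add_atTop_iff_nat M]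
  refine hsum.congr fun m => ?_
  rw [pushDirac, integral_sum_dirac, add_comm m, iterFibre_add, Multiset.map_bind,
    Multiset.sum_bind, Multiset.sum_map_div, div_div, pow_add, mul_comm (d ^ m), one_div_mul_eq_div]

end Pushforward

section Attractor

variable {ν : Measure (Metric.closedBall (0 : ℂ) R)} [IsProbabilityMeasure ν]

theorem isSelfSimilar_planeSupport (h : HasContractingBranches P f R q)
    (hν : IFS.Equidistributes h.branch ν) : IFS.IsSelfSimilar f (planeSupport ν) :=
  hν.isSelfSimilar_support.image fun _ _ => rfl

theorem isLeast_zeroInvariant_planeSupport (h : HasContractingBranches P f R q)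
    (hν : IFS.Equidistributes h.branch ν) : IsLeast {S | ZeroInvariant P S} (planeSupport ν) := by
  refine ⟨⟨isCompact_planeSupport.isClosed, ?_, fun z hz w hw => ?_⟩, fun S hS => ?_⟩
  · exact (Measure.nonempty_support (IsProbabilityMeasure.ne_zero ν)).image _
  · have hzR := mem_closedBall_zero_iff.1 (planeSupport_subset_closedBall hz)
    obtain ⟨i, rfl⟩ := (h.evalEval_eq_zero_iff hzR w).1 hw
    exact (h.isSelfSimilar_planeSupport hν).mapsTo i hz
  · obtain ⟨a, ha, haR⟩ := h.exists_mem_norm_le hS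
    refine Set.image_subset_iff.2 (hν.support_subset_of_mapsTo
      (hS.1.preimage continuous_subtype_val) ⟨⟨a, mem_closedBall_zero_iff.2 haR⟩, ha⟩ ?_)
    exact fun i x hx => hS.2.2 x hx _ (h.evalEval_branch (mem_closedBall_zero_iff.1 x.2) i)

theorem isLeast_forwardInvariant_support (h : HasContractingBranches P f R q)
    (hν : IFS.Equidistributes h.branch ν) :
    IsLeast {K : Set (OnePoint ℂ) | IsClosed K ∧ ForwardInvariant P K ∧
      ∃ a : ℂ, (a : OnePoint ℂ) ∈ K} (ν.map (discEmbedding R)).support := by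
  obtain ⟨⟨-, ⟨a, ha⟩, hinv⟩, hleast⟩ := h.isLeast_zeroInvariant_planeSupport hν
  rw [← image_coe_planeSupport]
  refine ⟨⟨?_, ?_, a, Set.mem_image_of_mem _ ha⟩, ?_⟩
  · exact (isCompact_planeSupport.image OnePoint.continuous_coe).isClosed
  · rintro _ ⟨z, hz, rfl⟩
    rw [h.image_coe]
    exact Set.image_mono (hinv z hz)
  · rintro K ⟨hK, hKinv, hne⟩
    exact Set.image_subset_iff.2 (hleast (zeroInvariant_preimage_coe hK hKinv hne))

end Attractor

end HasContractingBranches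

/-! ### The correspondence of a differential operator -/

section Operator

/-- The coefficients `n^{(j)} / n^{(k)}` of the correspondence, normalized to be `1` at `j = k`. -/
def weight (k n j : ℕ) : ℂ := (n.descFactorial j : ℂ) / (n.descFactorial k : ℂ)

variable {k n : ℕ}

theorem cast_descFactorial_ne_zero {j : ℕ} (hj : j ≤ n) : (n.descFactorial j : ℂ) ≠ 0 := by
  exact_mod_cast (Nat.descFactorial_pos.2 hj).ne'

theorem weight_div_weight_succ {j : ℕ} (hj : j < k) (hn : k ≤ n) :
    weight k n j / weight k n (j + 1) = ((n : ℂ) - j)⁻¹ := by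
  have hj0 := cast_descFactorial_ne_zero (hj.le.trans hn)
  have hk0 := cast_descFactorial_ne_zero hn
  rw [weight, weight, div_div_div_cancel_right₀ hk0, Nat.descFactorial_succ, Nat.cast_mul,
    div_mul_cancel_right₀ hj0, Nat.cast_sub (hj.le.trans hn)]

theorem tendsto_weight (k : ℕ) : Tendsto (weight k) atTop (smallWeights k) := by
  refine tendsto_smallWeights_iff.2 ⟨?_, fun j hj => ?_⟩
  · filter_upwards [eventually_ge_atTop k] with n hn
    have hk0 := cast_descFactorial_ne_zero hn
    exact ⟨div_self hk0, fun j hj => div_ne_zero (cast_descFactorial_ne_zero (hj.trans hn)) hk0⟩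
  · have hlim : Tendsto (fun n : ℕ => ((n : ℂ) - j)⁻¹) atTop (𝓝 0) :=
      tendsto_inv₀_cobounded.comp
        ((tendsto_sub_const_cobounded (j : ℂ)).comp tendsto_natCast_atTop_cobounded)
    refine hlim.congr' ?_
    filter_upwards [eventually_ge_atTop k] with n hn
    exact (weight_div_weight_succ hj hn).symm

theorem map_corrPoly (Q : ℕ → ℂ[X]) (hn : k ≤ n) (z : ℂ) :
    (corrPoly k Q n).map (evalRingHom z) =
      ∑ j ∈ Finset.range (k + 1), n.descFactorial j • (Q j * (X - C z) ^ (k - j)) := by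
  have hcomp : (evalRingHom z).comp C = RingHom.id ℂ := RingHom.ext fun a => by simp
  rw [corrPoly_eq k Q n hn, Polynomial.map_sum]
  refine Finset.sum_congr rfl fun j _ => ?_
  simp [Polynomial.map_map, hcomp]

theorem map_corrPoly_eq_mul_weighted (Q : ℕ → ℂ[X]) (hn : k ≤ n) (z : ℂ) :
    (corrPoly k Q n).map (evalRingHom z) =
      C (n.descFactorial k : ℂ) * weighted k Q (weight k n) z := by
  rw [map_corrPoly Q hn, weighted, Finset.mul_sum]
  refine Finset.sum_congr rfl fun j _ => ?_
  rw [← mul_assoc, ← C_mul, weight, mul_div_cancel₀ _ (cast_descFactorial_ne_zero hn)]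
  simp

theorem evalEval_corrPoly_eq_zero_iff (Q : ℕ → ℂ[X]) (hn : k ≤ n) (z w : ℂ) :
    (corrPoly k Q n).evalEval z w = 0 ↔ (weighted k Q (weight k n) z).IsRoot w := by
  rw [← eval₂_evalRingHom, ← eval_map, map_corrPoly_eq_mul_weighted Q hn, eval_mul, eval_C,
    mul_eq_zero_iff_left (cast_descFactorial_ne_zero hn), IsRoot]

theorem eval_diffOp (Q : ℕ → ℂ[X]) (hn : k ≤ n) (z w : ℂ) :
    (diffOp k Q ((X - C z) ^ n)).eval w =
      (w - z) ^ (n - k) * (corrPoly k Q n).evalEval z w := by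
  rw [diffOp_pow_eq_mul k Q z n hn, ← map_corrPoly Q hn, eval_mul, eval_map, eval₂_evalRingHom]
  simp

theorem hutchinsonInvariant_iff_zeroInvariant (Q : ℕ → ℂ[X]) (hn : k ≤ n) {S : Set ℂ} :
    HutchinsonInvariant k Q n S ↔ ZeroInvariant (corrPoly k Q n) S := by
  refine and_congr_right fun _ => and_congr_right fun _ => forall₂_congr fun z hz =>
    forall_congr' fun w => ?_
  rw [eval_diffOp Q hn, mul_eq_zero]
  refine ⟨fun h hw => h (Or.inr hw), fun h hw => hw.elim (fun hpow => ?_) h⟩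
  rwa [sub_eq_zero.1 (eq_zero_of_pow_eq_zero hpow)]

end Operator

section ContractingBranches

variable {k : ℕ} {Q : ℕ → ℂ[X]}

theorem TracksRoots.exists_hasContractingBranches {n : ℕ} {R ρ β : ℝ} {q : NNReal}
    (h : TracksRoots (Q k) (weighted k Q (weight k n)) R ρ β q) (hR : 0 < R) (hq : q < 1)
    (hnorm : ∀ z w, (weighted k Q (weight k n) z).IsRoot w → ‖w‖ < max (‖z‖ / 2) R)
    (hsep : (Q k).Separable) (hn : k ≤ n) :
    ∃ f : (Q k).rootSet ℂ → ℂ → ℂ, HasContractingBranches (corrPoly k Q n) f R q ∧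
      ∀ (u : (Q k).rootSet ℂ) (z : ℂ), ‖z‖ ≤ R → f u z ∈ Metric.ball (u : ℂ) ρ := by
  obtain ⟨f, hf⟩ := h.exists_isBranches hsep
  have hk0 := cast_descFactorial_ne_zero hn
  refine ⟨f, ⟨hR, fun z => ?_, fun z w hw => ?_, fun z hz => ?_, h.lipschitzOnWith hf,
    h.differentiableOn hf (contDiff_eval_weighted k Q _), hq⟩, hf.mem_ball⟩
  · rw [map_corrPoly_eq_mul_weighted Q hn, natDegree_C_mul hk0, h.natDegree_eq,
      card_rootSet_eq_natDegree hsep (IsAlgClosed.splits _)]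
  · exact hnorm z w ((evalEval_corrPoly_eq_zero_iff Q hn z w).1 hw)
  · rw [map_corrPoly_eq_mul_weighted Q hn, roots_C_mul _ hk0, hf.roots_eq z hz]

theorem NonDegenerate.exists_eventually_hasContractingBranches (hT : NonDegenerate k Q)
    (hsep : (Q k).Separable) {ε : ℝ} (hε : 0 < ε) {q : NNReal} (hq₀ : 0 < q) (hq : q < 1) :
    ∃ R, ∀ᶠ n in atTop, ∃ f : (Q k).rootSet ℂ → ℂ → ℂ,
      HasContractingBranches (corrPoly k Q n) f R q ∧
      (∀ (u : (Q k).rootSet ℂ) (z : ℂ), ‖z‖ ≤ R → f u z ∈ Metric.ball (u : ℂ) ε) ∧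
      ∀ z, ‖z‖ ≤ R → (weighted k Q (weight k n) z).Separable := by
  obtain ⟨R, hR, ρ, hρ, β, hev⟩ := hT.exists_eventually_tracksRoots hsep hε hq₀
  refine ⟨R, ?_⟩
  filter_upwards [(tendsto_weight k).eventually hev, eventually_ge_atTop k] with n h hn
  obtain ⟨htracks, hnorm⟩ := h
  obtain ⟨f, hf, hball⟩ := htracks.exists_hasContractingBranches hR hq hnorm hsep hn
  exact ⟨f, hf, fun u z hz => Metric.ball_subset_ball hρ (hball u z hz),
    fun _ => htracks.separable⟩

theorem subset_thickening_of_isSelfSimilar {p : ℂ[X]} {f : p.rootSet ℂ → ℂ → ℂ} {R ε : ℝ}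
    {S : Set ℂ} (hball : ∀ (u : p.rootSet ℂ) (z : ℂ), ‖z‖ ≤ R → f u z ∈ Metric.ball (u : ℂ) ε)
    (hSR : S ⊆ Metric.closedBall 0 R) (hS : IFS.IsSelfSimilar f S) :
    S ⊆ Metric.thickening ε {u | p.IsRoot u} := by
  intro x hx
  obtain ⟨u, y, hy, rfl⟩ := hS.covered x hx
  exact Metric.mem_thickening_iff.2 ⟨u, isRoot_of_mem_rootSet u.2,
    hball u y (mem_closedBall_zero_iff.1 (hSR hy))⟩

theorem HasContractingBranches.isCantorSet {P : ℂ[X][Y]} {ι : Type*} [Fintype ι] [Nonempty ι]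
    {f : ι → ℂ → ℂ} {R : ℝ} {q : NNReal} {S : Set ℂ} (h : HasContractingBranches P f R q)
    (hq : Fintype.card ι * q < 1) (hS : IFS.IsSelfSimilar f S) (hSR : S ⊆ Metric.closedBall 0 R)
    (hcompact : IsCompact S) (hcofibre : ∀ w, {z | P.evalEval z w = 0}.Finite)
    (hinf : S.Infinite) : IsCantorSet S := by
  refine IFS.nonempty_homeomorph_cantorSet hq (fun i => (h.lipschitz i).mono hSR) hS
    (fun i w _ => (hcofibre w).subset ?_) hcompact hinf
  rintro z ⟨hz, rfl⟩
  exact h.evalEval_branch (mem_closedBall_zero_iff.1 (hSR hz)) i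

theorem finite_setOf_evalEval_corrPoly_eq_zero {n : ℕ} (hn : k ≤ n)
    (hQ : ¬ ∃ c, ∀ j ≤ k, (Q j).eval c = 0) (w : ℂ) :
    {z | (corrPoly k Q n).evalEval z w = 0}.Finite := by
  simp only [evalEval_corrPoly_eq_zero_iff Q hn]
  refine finite_setOf_isRoot_weighted (fun j hj => ?_) hQ w
  exact div_ne_zero (cast_descFactorial_ne_zero (hj.trans hn)) (cast_descFactorial_ne_zero hn)

theorem NonDegenerate.eventually_infinite_of_zeroInvariant (hT : NonDegenerate k Q)
    (hd : 2 ≤ (Q k).natDegree) (hQ : ¬ ∃ c, ∀ j ≤ k, (Q j).eval c = 0) :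
    ∀ᶠ n in atTop, ∀ S, ZeroInvariant (corrPoly k Q n) S →
      (∀ z ∈ S, (weighted k Q (weight k n) z).Separable) → S.Infinite := by
  filter_upwards [(tendsto_weight k).eventually (hT.eventually_infinite_of_invariant hd hQ),
    eventually_ge_atTop k] with n h hn S hS hsep
  exact h S hS.2.1 hsep fun z hz w hw =>
    hS.2.2 z hz w ((evalEval_corrPoly_eq_zero_iff Q hn z w).2 hw)

end ContractingBranches

theorem exists_pos_lt_one_nat_mul_lt_one (d : ℕ) :
    ∃ q : NNReal, 0 < q ∧ q < 1 ∧ d * q < 1 := by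
  have hlt : (1 : NNReal) < d + 2 := by exact_mod_cast Nat.lt_add_left d one_lt_two
  refine ⟨(d + 2 : NNReal)⁻¹, by positivity, inv_lt_one_of_one_lt₀ hlt, ?_⟩
  rw [← div_eq_mul_inv, div_lt_one (by positivity)]
  exact lt_add_of_pos_right _ two_pos

end HolCorr

end

theorem theoremC_general (k : ℕ) (Q : ℕ → ℂ[X])
    (hT : HolCorr.NonDegenerate k Q)
    (hd : 1 ≤ (Q k).natDegree)
    (hsimple : ∀ u : ℂ, (Q k).IsRoot u → (Q k).rootMultiplicity u = 1)
    (ε : ℝ) (hε : 0 < ε) :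
    ∃ N : ℕ, k ≤ N ∧ ∀ n : ℕ, N ≤ n →
      ∃ (μ : Measure (OnePoint ℂ)) (S : Set ℂ),
        (HolCorr.corrPoly k Q n).natDegree = (Q k).natDegree ∧
        IsProbabilityMeasure μ ∧
        HolCorr.IsPushforward (HolCorr.corrPoly k Q n) μ
          (((Q k).natDegree : ENNReal) • μ) ∧
        (∀ (a : ℂ) (φ : C(OnePoint ℂ, ℝ)),
          Tendsto (fun m : ℕ => (1 / ((Q k).natDegree : ℝ) ^ m) *
              ∫ x, φ x ∂(HolCorr.pushDirac (HolCorr.corrPoly k Q n) m (a : OnePoint ℂ)))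
            atTop (𝓝 (∫ x, φ x ∂μ))) ∧
        μ.support ⊆ (fun u : ℂ => (u : OnePoint ℂ)) ''
          Metric.thickening ε {u : ℂ | (Q k).IsRoot u} ∧
        IsLeast {K : Set (OnePoint ℂ) | IsClosed K ∧
          HolCorr.ForwardInvariant (HolCorr.corrPoly k Q n) K ∧
          ∃ a : ℂ, (a : OnePoint ℂ) ∈ K} μ.support ∧
        IsLeast {S' : Set ℂ | HolCorr.HutchinsonInvariant k Q n S'} S ∧
        (fun u : ℂ => (u : OnePoint ℂ)) '' S = μ.support ∧
        (∀ w ∈ S, ∃ v : ℕ → ℂ,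
          (∀ i, HolCorr.IsAttractingPeriodic (HolCorr.corrPoly k Q n) (v i)) ∧
          Tendsto v atTop (𝓝 w)) ∧
        S ⊆ Metric.thickening ε {u : ℂ | (Q k).IsRoot u} ∧
        (2 ≤ (Q k).natDegree → (¬ ∃ c : ℂ, ∀ j ≤ k, (Q j).eval c = 0) →
          HolCorr.IsCantorSet S) := by
  have hsep := HolCorr.separable_of_forall_rootMultiplicity_eq_one hT.1 hsimple
  have hcard : Fintype.card ((Q k).rootSet ℂ) = (Q k).natDegree :=
    card_rootSet_eq_natDegree hsep (IsAlgClosed.splits _)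
  have : Nonempty ((Q k).rootSet ℂ) := Fintype.card_pos_iff.1 (hcard ▸ hd)
  obtain ⟨q, hq0, hq1, hdq⟩ :=
    HolCorr.exists_pos_lt_one_nat_mul_lt_one (Fintype.card ((Q k).rootSet ℂ))
  obtain ⟨R, hbranches⟩ := hT.exists_eventually_hasContractingBranches hsep hε hq0 hq1
  have hinfinite := eventually_imp_distrib_left.2 fun hd₂ : 2 ≤ (Q k).natDegree =>
    eventually_imp_distrib_left.2 (hT.eventually_infinite_of_zeroInvariant hd₂)
  obtain ⟨N, hN⟩ := eventually_atTop.1 (hbranches.and hinfinite)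
  refine ⟨max k N, le_max_left k N, fun n hn => ?_⟩
  have hkn := (le_max_left k N).trans hn
  obtain ⟨⟨f, h, hball, hsepW⟩, hinf⟩ := hN n ((le_max_right k N).trans hn)
  obtain ⟨ν, hprob, hν⟩ := h.exists_equidistributes_branch
  have hSR := HolCorr.planeSupport_subset_closedBall (ν := ν)
  have hself := h.isSelfSimilar_planeSupport hν
  have hleast := h.isLeast_zeroInvariant_planeSupport hν
  have hnear := HolCorr.subset_thickening_of_isSelfSimilar hball hSR hself
  simp only [HolCorr.hutchinsonInvariant_iff_zeroInvariant Q hkn, ← hcard]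
  refine ⟨ν.map (HolCorr.discEmbedding R), HolCorr.planeSupport ν, h.natDegree_eq,
    Measure.isProbabilityMeasure_map (HolCorr.discEmbedding R).continuous.aemeasurable,
    h.isPushforward_map hν, h.tendsto_pushDirac hν,
    HolCorr.image_coe_planeSupport ν ▸ Set.image_mono hnear,
    h.isLeast_forwardInvariant_support hν, hleast, HolCorr.image_coe_planeSupport ν,
    fun w hw => h.exists_seq_isAttractingPeriodic hSR hself hw, hnear, fun hd₂ hQ => ?_⟩
  exact h.isCantorSet hdq hself hSR HolCorr.isCompact_planeSupport
    (HolCorr.finite_setOf_evalEval_corrPoly_eq_zero hkn hQ)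
    (hinf (hcard ▸ hd₂) hQ _ hleast.1 fun z hz => hsepW z (mem_closedBall_zero_iff.1 (hSR hz)))

theorem theoremC (k : ℕ) (hk : 1 ≤ k) (Q : ℕ → ℂ[X])
    (hT : HolCorr.NonDegenerate k Q)
    (hd : 1 ≤ (Q k).natDegree)
    (hsimple : ∀ u : ℂ, (Q k).IsRoot u → (Q k).rootMultiplicity u = 1)
    (ε : ℝ) (hε : 0 < ε) :
    ∃ N : ℕ, k ≤ N ∧ ∀ n : ℕ, N ≤ n →
      ∃ (μ : Measure (OnePoint ℂ)) (S : Set ℂ),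
        -- the degree of `T_n` is `deg Q_k`
        (HolCorr.corrPoly k Q n).natDegree = (Q k).natDegree ∧
        -- the invariant probability measure `μ` of `T_n`
        IsProbabilityMeasure μ ∧
        HolCorr.IsPushforward (HolCorr.corrPoly k Q n) μ
          (((Q k).natDegree : ENNReal) • μ) ∧
        -- equidistribution of the images of every `a ∈ ℂ` (weak * convergence)
        (∀ (a : ℂ) (φ : C(OnePoint ℂ, ℝ)),
          Tendsto (fun m : ℕ => (1 / ((Q k).natDegree : ℝ) ^ m) *
              ∫ x, φ x ∂(HolCorr.pushDirac (HolCorr.corrPoly k Q n) m (a : OnePoint ℂ)))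
            atTop (𝓝 (∫ x, φ x ∂μ))) ∧
        μ.support ⊆ (fun u : ℂ => (u : OnePoint ℂ)) ''
          Metric.thickening ε {u : ℂ | (Q k).IsRoot u} ∧
        -- the support is the minimal closed forward invariant set containing a point of `ℂ`
        IsLeast {K : Set (OnePoint ℂ) | IsClosed K ∧
          HolCorr.ForwardInvariant (HolCorr.corrPoly k Q n) K ∧
          ∃ a : ℂ, (a : OnePoint ℂ) ∈ K} μ.support ∧
        -- the minimal Hutchinson invariant set `S` exists and equals the support
        IsLeast {S' : Set ℂ | HolCorr.HutchinsonInvariant k Q n S'} S ∧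
        (fun u : ℂ => (u : OnePoint ℂ)) '' S = μ.support ∧
        -- its points are limits of attracting periodic points and are close to the zeros of `Q_k`
        (∀ w ∈ S, ∃ v : ℕ → ℂ,
          (∀ i, HolCorr.IsAttractingPeriodic (HolCorr.corrPoly k Q n) (v i)) ∧
          Tendsto v atTop (𝓝 w)) ∧
        S ⊆ Metric.thickening ε {u : ℂ | (Q k).IsRoot u} ∧
        -- the Cantor property
        (2 ≤ k → (∃ j < k, Q j ≠ 0) →
          2 ≤ (Q k).natDegree → (¬ ∃ c : ℂ, ∀ j ≤ k, (Q j).eval c = 0) →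
          HolCorr.IsCantorSet S) := by
  obtain ⟨N, hkN, hN⟩ := theoremC_general k Q hT hd hsimple ε hε
  refine ⟨N, hkN, fun n hn => ?_⟩
  obtain ⟨μ, S, hdeg, hμ, hpush, hequi, hsupp, hmin, hleast, hS, hlim, hnear, hcantor⟩ := hN n hn
  exact ⟨μ, S, hdeg, hμ, hpush, hequi, hsupp, hmin, hleast, hS, hlim, hnear,
    fun _ _ => hcantor⟩
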